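/- Let $d\ge 1$, let $U=\{u_1,\dots,u_d\}$ be the vertex set of a clique, and let the set of colours be $[d+1]=\{1,\dots,d+1\}$. For a positive integer $t$, a list assignment $L:U\to 2^{[d+1]}$ is called $t$-feasible if $|L(u_i)|\ge t+1$ for every $i\le t$ and $|L(u_i)|=d+1$ for every $t<i\le d$. Let $\Omega^L_U$ be the set of $L$-colourings of the clique, i.e. of maps $\sigma:U\to[d+1]$ with $\sigma(u)\in L(u)$ for all $u$ and $\sigma(u)\ne\sigma(v)$ for all $u\neq v$. For $p_1,\dots,p_d>0$, the Glauber dynamics $\mathcal{L}^L_U$ with parameters $(p_1,\dots,p_d)$ is the continuous-time Markov chain on $\Omega^L_U$ that jumps from $\sigma$ to $\eta\ne\sigma$ at rate $p_i$ if $\sigma$ and $\eta$ differ only at $u_i$, and at rate $0$ if they differ at more than one vertex. Its spectral gap is the second smallest eigenvalue, counted with multiplicity, of $-\mathcal{L}^L_U$ (where $\mathcal{L}^L_U$ also denotes the generator matrix), and its relaxation time $\tau(\mathcal{L}^L_U)$ is the inverse of the spectral gap. For every positive integer $t$ there is a constant $C=C(t)>0$, depending only on $t$, such that for every $d\ge 1$,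 every $t$-feasible list assignment $L$ and all $p_1,\dots,p_d>0$, the chain $\mathcal{L}^L_U$ is ergodic (irreducible), its spectral gap is positive, and $$\tau(\mathcal{L}^L_U)\le C\left(\sum_{i=1}^{t}\frac{d}{p_i}+\sum_{i=t+1}^{d}\frac{1}{p_i}\right).$$ -/

import Mathlib

/-- The set of `L`-colourings of `G`: proper colourings `σ : V → [k]` with `σ v ∈ L v`. -/
abbrev ListColouring {V : Type*} {k : ℕ} (G : SimpleGraph V) (L : V → Finset (Fin k)) : Type _ :=
  {σ : V → Fin k // (∀ u v, G.Adj u v → σ u ≠ σ v) ∧ ∀ v, σ v ∈ L v}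

/-- The set of `L`-colourings of a finite graph is finite. -/
noncomputable instance ListColouring.instFintype {V : Type*} [Fintype V] {k : ℕ}
    (G : SimpleGraph V) (L : V → Finset (Fin k)) : Fintype (ListColouring G L) :=
  Fintype.ofFinite _

/-- Two colourings differ at the vertex `v` and at no other vertex. -/
def DifferOnlyAt {V : Type*} {k : ℕ} (σ η : V → Fin k) (v : V) : Prop :=
  σ v ≠ η v ∧ ∀ u, u ≠ v → σ u = η u

open Classical in
/-- The jump rate of the Glauber dynamics with parameters `p`: it is `p v` if `σ` and `η` differ
only at `v` (there is at most one such `v`, so the sum has at most one nonzero term), and `0` if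
there is no such vertex. -/
noncomputable def glauberRate {V : Type*} [Fintype V] {k : ℕ} (p : V → ℝ) (σ η : V → Fin k) : ℝ :=
  ∑ v, if DifferOnlyAt σ η v then p v else 0

open Classical in
/-- The generator matrix of the continuous-time Glauber dynamics on the `L`-colourings of `G` with
parameters `p`; the diagonal entries are such that every row adds up to `0`. -/
noncomputable def glauberGenerator {V : Type*} [Fintype V] {k : ℕ} (G : SimpleGraph V)
    (L : V → Finset (Fin k)) (p : V → ℝ) : Matrix (ListColouring G L) (ListColouring G L) ℝ :=
  Matrix.of fun σ η =>
    if σ = η then -∑ ξ ∈ Finset.univ.erase σ, glauberRate p σ.1 ξ.1 else glauberRate p σ.1 η.1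

/-- A continuous-time Markov chain on a finite state space with generator `Q` is ergodic if every
state can be reached from every other one through transitions of positive rate. -/
def IsErgodicGenerator {Ω : Type*} (Q : Matrix Ω Ω ℝ) : Prop :=
  ∀ x y, Relation.ReflTransGen (fun a b => a ≠ b ∧ 0 < Q a b) x y

open Classical in
/-- The spectral gap of a generator `Q`: the second smallest eigenvalue of `-Q`, counted with
multiplicity, i.e. the entry of index `1` in the increasing list of the roots of the characteristic
polynomial of `-Q`. It is meant for a symmetric `Q`, whose eigenvalues are all real. The default
value `0` is taken only if there is no second eigenvalue. -/
noncomputable def spectralGap {Ω : Type*} [Fintype Ω] (Q : Matrix Ω Ω ℝ) : ℝ :=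
  ((-Q).charpoly.roots.sort (· ≤ ·)).getD 1 0

/-- The relaxation time of a generator. -/
noncomputable def relaxationTime {Ω : Type*} [Fintype Ω] (Q : Matrix Ω Ω ℝ) : ℝ :=
  1 / spectralGap Q

/-- `t`-feasible list assignments of the clique `u_1, …, u_d` with `d + 1` colours; the vertex
`u_i` is the element `i - 1` of `Fin d`, so `i ≤ t` reads `(i - 1) < t`. -/
structure IsFeasible {d : ℕ} (t : ℕ) (L : Fin d → Finset (Fin (d + 1))) : Prop where
  constrained : ∀ i : Fin d, i.val < t → t + 1 ≤ (L i).card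
  free : ∀ i : Fin d, t ≤ i.val → (L i).card = d + 1

/-! A colouring of a `d`-clique with `d + 1` colours leaves exactly one colour unused, so it is a
permutation of the colours whose last position `h` holds the unused one. Recolouring `u_i` is right
multiplication by the transposition of `i` and `h`. Writing `D_j` for the Dirichlet form of that
transposition at `j`, the core is a Poincaré inequality (`listPerms_poincare`) in which a
constrained position contributes `(d + 1) D_i` and the free positions together contribute `(∑ √D_j)
^ 2`. Cauchy–Schwarz against the rates (`weighted_sum_le`) produces the weights `d / p_i` and `1 /
p_i`.

To prove it, let `F` be the average of `f` over the permutations with prescribed colours at the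
constrained positions. The deviation of `f` from `F` comes from permuting the remaining positions.
Such a permutation is a product of transpositions with `h` using each position at most twice
(`le_two_mul_sum_swap`), and `√D` is subadditive because it is an L² norm. The function `F` lives on
list colourings of a `t`-clique, which satisfy a Poincaré inequality whose constant depends only on
`t` (`cliqueColourings_poincare`). A recolouring there exchanges a constrained position with some
unconstrained position `j`, and this exchange is conjugate, by the transposition of `j` and `h`, to
the exchange with `h`. Summing over at most `d + 1` choices of `j` gives the factor `d`.

The same inequality yields irreducibility (`isErgodicGenerator_of_poincare`) and the gap
(`inv_le_spectralGap_of_poincare`). -/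

/-! ### Counting list colourings of a clique -/

/-- The proper colourings of the complete graph on `Fin n` with colours from the lists `L`. -/
def cliqueColourings {κ : Type*} [DecidableEq κ] {n : ℕ} (L : Fin n → Finset κ) :
    Finset (Fin n → κ) :=
  (Fintype.piFinset L).filter Function.Injective

theorem mem_cliqueColourings {κ : Type*} [DecidableEq κ] {n : ℕ} {L : Fin n → Finset κ}
    {x : Fin n → κ} :
    x ∈ cliqueColourings L ↔ (∀ i, x i ∈ L i) ∧ Function.Injective x := by
  simp [cliqueColourings]

theorem cons_mem_cliqueColourings {κ : Type*} [DecidableEq κ] {n : ℕ}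
    {L : Fin (n + 1) → Finset κ} {z : κ} {u : Fin n → κ} :
    Fin.cons z u ∈ cliqueColourings L ↔
      z ∈ L 0 ∧ u ∈ cliqueColourings fun j => (L j.succ).erase z := by
  simp only [mem_cliqueColourings, Fin.forall_fin_succ, Fin.cons_zero, Fin.cons_succ,
    Fin.cons_injective_iff, Finset.mem_erase, Set.mem_range, not_exists]
  grind

theorem sum_cliqueColourings_succ {κ : Type*} [DecidableEq κ] {n : ℕ}
    (L : Fin (n + 1) → Finset κ) (g : (Fin (n + 1) → κ) → ℝ) :
    ∑ x ∈ cliqueColourings L, g x =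
      ∑ z ∈ L 0, ∑ u ∈ cliqueColourings (fun j => (L j.succ).erase z), g (Fin.cons z u) := by
  rw [Finset.sum_sigma']
  refine Finset.sum_bij' (fun x _ => (⟨x 0, Fin.tail x⟩ : Σ _ : κ, Fin n → κ))
    (fun p _ => Fin.cons p.1 p.2) ?_ ?_ ?_ ?_ ?_
  · intro x hx
    rw [← Fin.cons_self_tail x, cons_mem_cliqueColourings] at hx
    simpa using hx
  · rintro ⟨z, u⟩ h
    rw [cons_mem_cliqueColourings]
    simpa using h
  · intro x _
    simp
  · rintro ⟨z, u⟩ _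
    simp
  · intro x _
    simp

theorem card_cliqueColourings_succ {κ : Type*} [DecidableEq κ] {n : ℕ}
    (L : Fin (n + 1) → Finset κ) :
    ((cliqueColourings L).card : ℝ) =
      ∑ z ∈ L 0, ((cliqueColourings (fun j => (L j.succ).erase z)).card : ℝ) := by
  simpa using sum_cliqueColourings_succ L fun _ => 1

/-- If every list has at least as many colours as there are vertices, then a positive proportion
of the elements of the product of the lists is injective. -/
theorem prod_card_le_card_cliqueColourings {κ : Type*} [DecidableEq κ] {n : ℕ} {m : ℝ}
    (hm : (n : ℝ) ≤ m) (L : Fin n → Finset κ) (hL : ∀ i, n ≤ (L i).card) :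
    ∏ i, ((L i).card : ℝ) ≤ m ^ n * (cliqueColourings L).card := by
  induction n with
  | zero =>
    have : cliqueColourings L = {Fin.elim0} := by
      ext x
      simp [mem_cliqueColourings, Function.injective_of_subsingleton, Subsingleton.elim x Fin.elim0]
    simp [this]
  | succ n ih =>
    have hm0 : (0 : ℝ) ≤ m := le_trans (by positivity) hm
    have hn : (n : ℝ) ≤ m := le_trans (by push_cast; linarith) hm
    have ih' := ih hn (fun j => L j.succ) fun j => le_trans (by omega) (hL j.succ)
    -- Colour vertex 0 last: the other vertices block at most `n` of its colours.
    have hsum : ((L 0).card - n : ℝ) * (cliqueColourings fun j => L j.succ).card ≤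
        (cliqueColourings L).card := by
      have h1 : ((cliqueColourings L).card : ℝ) =
          ∑ u ∈ cliqueColourings (fun j => L j.succ),
            ((L 0 \ Finset.univ.image u).card : ℝ) := by
        rw [card_cliqueColourings_succ]
        have h2 : ∀ z, ((cliqueColourings (fun j => (L j.succ).erase z)).card : ℝ) =
            ∑ u ∈ cliqueColourings (fun j => L j.succ),
              if z ∉ Finset.univ.image u then (1 : ℝ) else 0 := by
          intro z
          rw [Finset.sum_boole]
          congr 2
          ext u
          simp only [mem_cliqueColourings, Finset.mem_erase, Finset.mem_filter, Finset.mem_image,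
            Finset.mem_univ, true_and]
          grind
        simp_rw [h2]
        rw [Finset.sum_comm]
        refine Finset.sum_congr rfl fun u _ => ?_
        rw [Finset.sum_boole, Finset.sdiff_eq_filter]
      rw [h1, mul_comm, ← nsmul_eq_mul]
      refine Finset.card_nsmul_le_sum _ _ _ fun u _ => ?_
      have h3 := Finset.le_card_sdiff (Finset.univ.image u) (L 0)
      have h4 : (Finset.univ.image u).card ≤ n := by
        simpa using Finset.card_image_le (s := Finset.univ) (f := u)
      have h5 : (L 0).card ≤ (L 0 \ Finset.univ.image u).card + n := by omega
      have h6 : ((L 0).card : ℝ) ≤ (L 0 \ Finset.univ.image u).card + n := by exact_mod_cast h5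
      linarith
    have h0 : ((n + 1 : ℕ) : ℝ) ≤ (L 0).card := by exact_mod_cast hL 0
    push_cast at h0 hm
    -- With `s = |L 0| - n ≥ 1`, this is `n + s ≤ (n + 1) s ≤ m s`. Keeping `m` fixed in the
    -- induction makes the factors multiply to a power.
    have hmul : ((L 0).card : ℝ) ≤ m * ((L 0).card - n) := by
      nlinarith [Nat.cast_nonneg (α := ℝ) n]
    rw [Fin.prod_univ_succ]
    calc ((L 0).card : ℝ) * ∏ j, ((L (Fin.succ j)).card : ℝ)
        ≤ (m * ((L 0).card - n)) * (m ^ n * (cliqueColourings fun j => L j.succ).card) := by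
          refine mul_le_mul hmul ih' (Finset.prod_nonneg fun _ _ => Nat.cast_nonneg _) ?_
          exact le_trans (Nat.cast_nonneg _) hmul
      _ = m ^ (n + 1) * (((L 0).card - n) * (cliqueColourings fun j => L j.succ).card) := by ring
      _ ≤ m ^ (n + 1) * (cliqueColourings L).card :=
          mul_le_mul_of_nonneg_left hsum (pow_nonneg hm0 _)

theorem card_cliqueColourings_le {κ : Type*} [DecidableEq κ] {n : ℕ} (L : Fin n → Finset κ) :
    ((cliqueColourings L).card : ℝ) ≤ ∏ i, ((L i).card : ℝ) := by
  have := Finset.card_filter_le (Fintype.piFinset L) Function.Injective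
  rw [Fintype.card_piFinset] at this
  exact_mod_cast this

/-! ### Poincaré inequality for list colourings of a clique -/

/-- The Dirichlet form of the recolourings of the vertex `i`. -/
def cliqueDirichlet {κ : Type*} [DecidableEq κ] {n : ℕ} (L : Fin n → Finset κ)
    (F : (Fin n → κ) → ℝ) (i : Fin n) : ℝ :=
  ∑ x ∈ cliqueColourings L, ∑ c ∈ L i,
    if Function.update x i c ∈ cliqueColourings L then (F x - F (Function.update x i c)) ^ 2 else 0

theorem cliqueDirichlet_nonneg {κ : Type*} [DecidableEq κ] {n : ℕ} (L : Fin n → Finset κ)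
    (F : (Fin n → κ) → ℝ) (i : Fin n) : 0 ≤ cliqueDirichlet L F i :=
  Finset.sum_nonneg fun _ _ => Finset.sum_nonneg fun _ _ => by split_ifs <;> positivity

theorem sum_cliqueDirichlet_erase_le {κ : Type*} [DecidableEq κ] {n : ℕ}
    (L : Fin (n + 1) → Finset κ) (F : (Fin (n + 1) → κ) → ℝ) (j : Fin n) :
    ∑ z ∈ L 0, cliqueDirichlet (fun j => (L j.succ).erase z) (fun u => F (Fin.cons z u)) j ≤
      cliqueDirichlet L F j.succ := by
  rw [cliqueDirichlet, sum_cliqueColourings_succ]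
  refine Finset.sum_le_sum fun z hz => Finset.sum_le_sum fun u _ => ?_
  simp only [← Fin.cons_update, cons_mem_cliqueColourings, hz, true_and]
  exact Finset.sum_le_sum_of_subset_of_nonneg (Finset.erase_subset _ _)
    fun _ _ _ => by split_ifs <;> positivity

/-- A tail `w` that avoids both `z` and `z'` allows vertex 0 to be recoloured from `z` to `z'` in
one move. -/
theorem sum_sq_sub_cons_le_cliqueDirichlet {κ : Type*} [DecidableEq κ] {n : ℕ}
    (L : Fin (n + 1) → Finset κ) (F : (Fin (n + 1) → κ) → ℝ) :
    ∑ z ∈ L 0, ∑ z' ∈ L 0,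
      ∑ w ∈ cliqueColourings (fun j => ((L j.succ).erase z).erase z'),
        (F (Fin.cons z w) - F (Fin.cons z' w)) ^ 2 ≤ cliqueDirichlet L F 0 := by
  rw [cliqueDirichlet, sum_cliqueColourings_succ]
  refine Finset.sum_le_sum fun z hz => ?_
  rw [Finset.sum_comm]
  refine Finset.sum_le_sum fun z' hz' => ?_
  simp only [Fin.update_cons_zero, cons_mem_cliqueColourings, hz', true_and]
  rw [← Finset.sum_filter]
  refine Finset.sum_le_sum_of_subset_of_nonneg ?_ fun _ _ _ => by positivity
  intro w
  simp only [mem_cliqueColourings, Finset.mem_filter, Finset.mem_erase]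
  grind

theorem sq_sub_le_three_mul (a b c d : ℝ) :
    (a - d) ^ 2 ≤ 3 * ((a - b) ^ 2 + (b - c) ^ 2 + (c - d) ^ 2) := by
  nlinarith [sq_nonneg ((a - b) - (b - c)), sq_nonneg ((b - c) - (c - d)),
    sq_nonneg ((a - b) - (c - d))]

/-- Erasing two colours leaves at least `n ≥ 1` of them in each list, so each list shrinks by a
factor of at most 3 and the counting bound still applies. -/
theorem prod_card_le_card_cliqueColourings_erase {κ : Type*} [DecidableEq κ] {n : ℕ}
    (L : Fin n → Finset κ) (hL : ∀ i, n + 2 ≤ (L i).card) (z z' : κ) :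
    ∏ i, ((L i).card : ℝ) ≤
      (3 * n) ^ n * (cliqueColourings fun i => ((L i).erase z).erase z').card := by
  have hcard : ∀ i, (L i).card ≤ (((L i).erase z).erase z').card + 2 := fun i => by
    have h1 := Finset.pred_card_le_card_erase (s := L i) (a := z)
    have h2 := Finset.pred_card_le_card_erase (s := (L i).erase z) (a := z')
    omega
  have h := prod_card_le_card_cliqueColourings (le_refl (n : ℝ))
    (fun i => ((L i).erase z).erase z') fun i => by have := hcard i; have := hL i; omega
  calc ∏ i, ((L i).card : ℝ) ≤ ∏ i, (3 * ((((L i).erase z).erase z').card : ℝ)) := by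
        refine Finset.prod_le_prod (fun _ _ => Nat.cast_nonneg _) fun i _ => ?_
        have h1 := hcard i
        have h2 := hL i
        have h3 := i.pos
        have h4 : (L i).card ≤ 3 * (((L i).erase z).erase z').card := by omega
        exact_mod_cast h4
    _ = 3 ^ n * ∏ i, ((((L i).erase z).erase z').card : ℝ) := by
        simp [Finset.prod_mul_distrib]
    _ ≤ 3 ^ n * (n ^ n * (cliqueColourings fun i => ((L i).erase z).erase z').card) :=
        mul_le_mul_of_nonneg_left h (by positivity)
    _ = _ := by ring

/-- The pair is joined by the path `(z, u) → (z, w) → (z', w) → (z', v)`, averaged over all tails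
`w` compatible with both `z` and `z'`. These tails are a positive proportion of all tails, so the
averaging costs only a constant depending on `n`. -/
theorem sum_sq_sub_cons_le {κ : Type*} [DecidableEq κ] {n : ℕ}
    (L : Fin n → Finset κ) (hL : ∀ i, n + 2 ≤ (L i).card) (F : (Fin (n + 1) → κ) → ℝ)
    (z z' : κ) :
    ∑ u ∈ cliqueColourings (fun j => (L j).erase z),
      ∑ v ∈ cliqueColourings (fun j => (L j).erase z'),
        (F (Fin.cons z u) - F (Fin.cons z' v)) ^ 2 ≤
    3 * (3 * n) ^ n *
      (∑ u ∈ cliqueColourings (fun j => (L j).erase z),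
        ∑ w ∈ cliqueColourings (fun j => (L j).erase z),
          (F (Fin.cons z u) - F (Fin.cons z w)) ^ 2 +
      (∏ i, ((L i).card : ℝ)) * ∑ w ∈ cliqueColourings (fun j => ((L j).erase z).erase z'),
        (F (Fin.cons z w) - F (Fin.cons z' w)) ^ 2 +
      ∑ w ∈ cliqueColourings (fun j => (L j).erase z'),
        ∑ v ∈ cliqueColourings (fun j => (L j).erase z'),
          (F (Fin.cons z' w) - F (Fin.cons z' v)) ^ 2) := by
  set A := cliqueColourings (fun j => (L j).erase z) with hA
  set B := cliqueColourings (fun j => (L j).erase z') with hB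
  set W := cliqueColourings (fun j => ((L j).erase z).erase z') with hW
  set M := ∏ i, ((L i).card : ℝ) with hM
  have hM0 : 0 < M := Finset.prod_pos fun i _ => by
    have := hL i
    exact_mod_cast (by omega : 0 < (L i).card)
  have hWA : W ⊆ A := fun w => by
    simp only [hW, hA, mem_cliqueColourings, Finset.mem_erase]
    grind
  have hWB : W ⊆ B := fun w => by
    simp only [hW, hB, mem_cliqueColourings, Finset.mem_erase]
    grind
  have hle : ∀ c : κ, ((cliqueColourings (fun j => (L j).erase c)).card : ℝ) ≤ M := fun c =>
    (card_cliqueColourings_le _).trans <| Finset.prod_le_prod (fun _ _ => Nat.cast_nonneg _)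
      fun i _ => by exact_mod_cast Finset.card_le_card (Finset.erase_subset c (L i))
  have hAM : (A.card : ℝ) ≤ M := hle z
  have hBM : (B.card : ℝ) ≤ M := hle z'
  have hMW : M ≤ (3 * n) ^ n * W.card := prod_card_le_card_cliqueColourings_erase L hL z z'
  have hpair : ∀ u v, (W.card : ℝ) * (F (Fin.cons z u) - F (Fin.cons z' v)) ^ 2 ≤
      3 * (∑ w ∈ W, (F (Fin.cons z u) - F (Fin.cons z w)) ^ 2 +
        ∑ w ∈ W, (F (Fin.cons z w) - F (Fin.cons z' w)) ^ 2 +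
        ∑ w ∈ W, (F (Fin.cons z' w) - F (Fin.cons z' v)) ^ 2) := by
    intro u v
    rw [← Finset.sum_add_distrib, ← Finset.sum_add_distrib, Finset.mul_sum, ← nsmul_eq_mul]
    exact Finset.card_nsmul_le_sum _ _ _ fun w _ => sq_sub_le_three_mul _ _ _ _
  have h1 : ∑ u ∈ A, ∑ w ∈ W, (F (Fin.cons z u) - F (Fin.cons z w)) ^ 2 ≤
      ∑ u ∈ A, ∑ w ∈ A, (F (Fin.cons z u) - F (Fin.cons z w)) ^ 2 :=
    Finset.sum_le_sum fun u _ =>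
      Finset.sum_le_sum_of_subset_of_nonneg hWA fun _ _ _ => sq_nonneg _
  have h2 : ∑ v ∈ B, ∑ w ∈ W, (F (Fin.cons z' w) - F (Fin.cons z' v)) ^ 2 ≤
      ∑ w ∈ B, ∑ v ∈ B, (F (Fin.cons z' w) - F (Fin.cons z' v)) ^ 2 := by
    rw [Finset.sum_comm]
    exact Finset.sum_le_sum_of_subset_of_nonneg hWB
      fun _ _ _ => Finset.sum_nonneg fun _ _ => sq_nonneg _
  set S := ∑ w ∈ W, (F (Fin.cons z w) - F (Fin.cons z' w)) ^ 2 with hS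
  have hS0 : 0 ≤ S := Finset.sum_nonneg fun _ _ => sq_nonneg _
  have hVA : 0 ≤ ∑ u ∈ A, ∑ w ∈ A, (F (Fin.cons z u) - F (Fin.cons z w)) ^ 2 :=
    Finset.sum_nonneg fun _ _ => Finset.sum_nonneg fun _ _ => sq_nonneg _
  have hVB : 0 ≤ ∑ w ∈ B, ∑ v ∈ B, (F (Fin.cons z' w) - F (Fin.cons z' v)) ^ 2 :=
    Finset.sum_nonneg fun _ _ => Finset.sum_nonneg fun _ _ => sq_nonneg _
  have hT : 0 ≤ ∑ u ∈ A, ∑ v ∈ B, (F (Fin.cons z u) - F (Fin.cons z' v)) ^ 2 :=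
    Finset.sum_nonneg fun _ _ => Finset.sum_nonneg fun _ _ => sq_nonneg _
  have hsum : (W.card : ℝ) * ∑ u ∈ A, ∑ v ∈ B, (F (Fin.cons z u) - F (Fin.cons z' v)) ^ 2 ≤
      3 * ((B.card : ℝ) * ∑ u ∈ A, ∑ w ∈ W, (F (Fin.cons z u) - F (Fin.cons z w)) ^ 2 +
        A.card * (B.card * S) +
        A.card * ∑ v ∈ B, ∑ w ∈ W, (F (Fin.cons z' w) - F (Fin.cons z' v)) ^ 2) := by
    have := Finset.sum_le_sum fun u (_ : u ∈ A) =>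
      Finset.sum_le_sum fun v (_ : v ∈ B) => hpair u v
    simp only [← Finset.mul_sum, Finset.sum_add_distrib, Finset.sum_const, nsmul_eq_mul] at this
    linarith
  refine le_of_mul_le_mul_left ?_ hM0
  set VA := ∑ u ∈ A, ∑ w ∈ A, (F (Fin.cons z u) - F (Fin.cons z w)) ^ 2
  set VB := ∑ w ∈ B, ∑ v ∈ B, (F (Fin.cons z' w) - F (Fin.cons z' v)) ^ 2
  have hA0 : (0 : ℝ) ≤ A.card := Nat.cast_nonneg _
  have hB0 : (0 : ℝ) ≤ B.card := Nat.cast_nonneg _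
  calc M * _ ≤ ((3 * n) ^ n * W.card) * _ := mul_le_mul_of_nonneg_right hMW hT
    _ = (3 * n) ^ n * (W.card * _) := by rw [mul_assoc]
    _ ≤ (3 * n) ^ n * (3 * (M * VA + M * (M * S) + M * VB)) := by
        refine mul_le_mul_of_nonneg_left (hsum.trans ?_) (by positivity)
        have e1 : (B.card : ℝ) * ∑ u ∈ A, ∑ w ∈ W, (F (Fin.cons z u) - F (Fin.cons z w)) ^ 2 ≤
            M * VA := (mul_le_mul_of_nonneg_left h1 hB0).trans (mul_le_mul_of_nonneg_right hBM hVA)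
        have e2 : (A.card : ℝ) *
            ∑ v ∈ B, ∑ w ∈ W, (F (Fin.cons z' w) - F (Fin.cons z' v)) ^ 2 ≤ M * VB :=
          (mul_le_mul_of_nonneg_left h2 hA0).trans (mul_le_mul_of_nonneg_right hAM hVB)
        have e3 : (A.card : ℝ) * (B.card * S) ≤ M * (M * S) :=
          mul_le_mul hAM (mul_le_mul_of_nonneg_right hBM hS0) (mul_nonneg hB0 hS0) hM0.le
        linarith
    _ = _ := by ring

/-- The Poincaré inequality for list colourings of a clique with `n` vertices and lists of at
least `n + 1` colours, with a constant that does not depend on the lists. -/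
theorem cliqueColourings_poincare (n : ℕ) :
    ∃ C : ℝ, 0 ≤ C ∧ ∀ (κ : Type) [DecidableEq κ] (L : Fin n → Finset κ),
      (∀ i, n + 1 ≤ (L i).card) → ∀ F : (Fin n → κ) → ℝ,
        ∑ x ∈ cliqueColourings L, ∑ y ∈ cliqueColourings L, (F x - F y) ^ 2 ≤
          C * ∑ i, (∏ k, if k = i then 1 else ((L k).card : ℝ)) * cliqueDirichlet L F i := by
  induction n with
  | zero =>
    refine ⟨0, le_rfl, fun κ _ L _ F => ?_⟩
    refine (Finset.sum_nonpos fun x _ => Finset.sum_nonpos fun y _ => ?_).trans_eq (by simp)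
    simp [Subsingleton.elim x y]
  | succ n ih =>
    obtain ⟨C, hC, ih⟩ := ih
    -- The path comparison costs `3 * (3 * n) ^ n`. The inductive constant enters twice, for the
    -- legs at `z` and at `z'`, and the 1 is for the recolouring of vertex 0.
    refine ⟨3 * (3 * n) ^ n * (1 + 2 * C), by positivity, fun κ _ L hL F => ?_⟩
    set K : ℝ := 3 * (3 * n) ^ n with hK
    have hK0 : 0 ≤ K := by positivity
    set M := ∏ i : Fin n, ((L i.succ).card : ℝ) with hM
    have hM0 : 0 ≤ M := Finset.prod_nonneg fun _ _ => Nat.cast_nonneg _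
    set V : κ → ℝ := fun z => ∑ u ∈ cliqueColourings (fun j => (L j.succ).erase z),
        ∑ w ∈ cliqueColourings (fun j => (L j.succ).erase z),
          (F (Fin.cons z u) - F (Fin.cons z w)) ^ 2 with hV
    set m : Fin n → ℝ := fun j => ∏ k, if k = j then 1 else ((L k.succ).card : ℝ) with hm
    have hm0 : ∀ j, 0 ≤ m j := fun j => Finset.prod_nonneg fun _ _ => by split_ifs <;> positivity
    have hVle : ∑ z ∈ L 0, V z ≤ C * ∑ j, m j * cliqueDirichlet L F j.succ := by
      calc ∑ z ∈ L 0, V z ≤ ∑ z ∈ L 0, C * ∑ j, m j *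
            cliqueDirichlet (fun j => (L j.succ).erase z) (fun u => F (Fin.cons z u)) j := by
            refine Finset.sum_le_sum fun z _ => (ih κ _ (fun j => ?_) _).trans ?_
            · have h1 := Finset.pred_card_le_card_erase (s := L j.succ) (a := z)
              have h2 := hL j.succ
              omega
            · refine mul_le_mul_of_nonneg_left (Finset.sum_le_sum fun j _ => ?_) hC
              refine mul_le_mul_of_nonneg_right ?_ (cliqueDirichlet_nonneg _ _ _)
              refine Finset.prod_le_prod (fun _ _ => by split_ifs <;> positivity) fun k _ => ?_
              split_ifs
              · exact le_rfl
              · exact_mod_cast Finset.card_le_card (Finset.erase_subset z (L k.succ))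
        _ = C * ∑ j, m j * ∑ z ∈ L 0,
            cliqueDirichlet (fun j => (L j.succ).erase z) (fun u => F (Fin.cons z u)) j := by
            rw [← Finset.mul_sum, Finset.sum_comm]
            simp_rw [Finset.mul_sum]
        _ ≤ _ := mul_le_mul_of_nonneg_left (Finset.sum_le_sum fun j _ =>
            mul_le_mul_of_nonneg_left (sum_cliqueDirichlet_erase_le L F j) (hm0 j)) hC
    have hE := sum_sq_sub_cons_le_cliqueDirichlet L F
    have hexp : ∑ x ∈ cliqueColourings L, ∑ y ∈ cliqueColourings L, (F x - F y) ^ 2 =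
        ∑ z ∈ L 0, ∑ z' ∈ L 0, ∑ u ∈ cliqueColourings (fun j => (L j.succ).erase z),
          ∑ v ∈ cliqueColourings (fun j => (L j.succ).erase z'),
            (F (Fin.cons z u) - F (Fin.cons z' v)) ^ 2 := by
      simp_rw [sum_cliqueColourings_succ]
      exact Finset.sum_congr rfl fun z _ => Finset.sum_comm
    have hstep : ∑ x ∈ cliqueColourings L, ∑ y ∈ cliqueColourings L, (F x - F y) ^ 2 ≤
        K * (2 * ((L 0).card * ∑ z ∈ L 0, V z) + M * cliqueDirichlet L F 0) := by
      rw [hexp]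
      calc _ ≤ ∑ z ∈ L 0, ∑ z' ∈ L 0, K * (V z + M *
            ∑ w ∈ cliqueColourings (fun j => ((L j.succ).erase z).erase z'),
              (F (Fin.cons z w) - F (Fin.cons z' w)) ^ 2 + V z') :=
            Finset.sum_le_sum fun z _ => Finset.sum_le_sum fun z' _ =>
              sum_sq_sub_cons_le (fun j => L j.succ) (fun j => hL j.succ) F z z'
        _ = K * (2 * ((L 0).card * ∑ z ∈ L 0, V z) + M * ∑ z ∈ L 0, ∑ z' ∈ L 0,
            ∑ w ∈ cliqueColourings (fun j => ((L j.succ).erase z).erase z'),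
              (F (Fin.cons z w) - F (Fin.cons z' w)) ^ 2) := by
            simp only [← Finset.mul_sum, Finset.sum_add_distrib, Finset.sum_const, nsmul_eq_mul]
            ring
        _ ≤ _ := mul_le_mul_of_nonneg_left
            (add_le_add_right (mul_le_mul_of_nonneg_left hE hM0) _) hK0
    have hprod0 : (∏ k, if k = (0 : Fin (n + 1)) then 1 else ((L k).card : ℝ)) = M := by
      simp [Fin.prod_univ_succ, Fin.succ_ne_zero, hM]
    have hprods : ∀ j : Fin n, (∏ k, if k = j.succ then 1 else ((L k).card : ℝ)) =
        (L 0).card * m j := by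
      intro j
      simp [Fin.prod_univ_succ, (Fin.succ_ne_zero _).symm, hm]
    rw [Fin.sum_univ_succ, hprod0]
    simp_rw [hprods, mul_assoc, ← Finset.mul_sum]
    set T := ∑ j, m j * cliqueDirichlet L F j.succ with hT
    have hT0 : 0 ≤ T := Finset.sum_nonneg fun j _ =>
      mul_nonneg (hm0 j) (cliqueDirichlet_nonneg _ _ _)
    have hE0 : 0 ≤ M * cliqueDirichlet L F 0 := mul_nonneg hM0 (cliqueDirichlet_nonneg _ _ _)
    have hl : (0 : ℝ) ≤ (L 0).card := Nat.cast_nonneg _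
    refine hstep.trans (mul_le_mul_of_nonneg_left ?_ hK0)
    have h1 := mul_le_mul_of_nonneg_left hVle hl
    nlinarith [mul_nonneg hl hT0, mul_nonneg hC hE0]

/-! ### Factoring permutations into transpositions with a fixed point -/

open Equiv in
/-- Every permutation is a product of transpositions with a fixed point `h` in which each of the
points that it moves is used at most twice. This is stated for a subadditive function. -/
theorem le_two_mul_sum_swap {ι : Type*} [DecidableEq ι] (h : ι)
    (c : Perm ι → ℝ) (hone : c 1 = 0) (hnonneg : ∀ g, 0 ≤ c g)
    (hmul : ∀ g g', c (g * g') ≤ c g + c g') (A : Finset ι) :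
    ∀ g : Perm ι, (∀ x, x ∉ A → x ≠ h → g x = x) → c g ≤ 2 * ∑ j ∈ A, c (swap j h) := by
  -- The extra term when `g` moves `h` is what makes the induction close. If `g k = h`, multiplying
  -- by `swap k h` removes `k` from the cycle of `h`. If `g` fixes `h`, multiplying by one `swap j
  -- h` merges another cycle into that of `h`, and the extra term pays for it.
  suffices H : ∀ g : Perm ι, (∀ x, x ∉ A → x ≠ h → g x = x) →
      (g h ≠ h → c g + c (swap (g h) h) ≤ 2 * ∑ j ∈ A, c (swap j h)) ∧
      (g h = h → c g ≤ 2 * ∑ j ∈ A, c (swap j h)) by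
    intro g hg
    by_cases hh : g h = h
    · exact (H g hg).2 hh
    · linarith [(H g hg).1 hh, hnonneg (swap (g h) h)]
  induction A using Finset.strongInduction with
  | H A ih =>
    have moved : ∀ g : Perm ι, (∀ x, x ∉ A → x ≠ h → g x = x) → g h ≠ h →
        c g + c (swap (g h) h) ≤ 2 * ∑ j ∈ A, c (swap j h) := by
      intro g hg hh
      obtain ⟨k, hk⟩ := g.surjective h
      have hkh : k ≠ h := by rintro rfl; exact hh hk
      have hkA : k ∈ A := by
        by_contra hkA
        exact hkh ((hg k hkA hkh).symm.trans hk)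
      have hg' : ∀ x, x ∉ A.erase k → x ≠ h → (swap k h * g) x = x := by
        intro x hx hxh
        by_cases hxk : x = k
        · simp [hxk, hk]
        · have hxA : x ∉ A := fun hxA => hx (Finset.mem_erase.2 ⟨hxk, hxA⟩)
          rw [Perm.mul_apply, hg x hxA hxh, swap_apply_of_ne_of_ne hxk hxh]
      have hIH := ih _ (Finset.erase_ssubset hkA) _ hg'
      have hcg : c g ≤ c (swap k h) + c (swap k h * g) := by
        simpa using hmul (swap k h) (swap k h * g)
      rw [← Finset.add_sum_erase _ _ hkA]
      by_cases hghk : g h = k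
      · have := hIH.2 (by simp [hghk])
        rw [hghk]
        linarith
      · have hval : (swap k h * g) h = g h := by
          rw [Perm.mul_apply, swap_apply_of_ne_of_ne hghk hh]
        have := hIH.1 (by rwa [hval])
        rw [hval] at this
        linarith [hnonneg (swap k h)]
    intro g hg
    refine ⟨moved g hg, fun hh => ?_⟩
    by_cases hg1 : g = 1
    · rw [hg1, hone]
      exact mul_nonneg zero_le_two (Finset.sum_nonneg fun _ _ => hnonneg _)
    · obtain ⟨j, hj⟩ : ∃ j, g j ≠ j := by
        by_contra! hall
        exact hg1 (Perm.ext hall)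
      have hjh : j ≠ h := by rintro rfl; exact hj hh
      have hjA : j ∈ A := by
        by_contra hjA
        exact hj (hg j hjA hjh)
      have hval : (swap j h * g) h = j := by simp [hh]
      have := moved (swap j h * g) (fun x hx hxh => by
        have hxj : x ≠ j := by rintro rfl; exact hx hjA
        rw [Perm.mul_apply, hg x hx hxh, swap_apply_of_ne_of_ne hxj hxh]) (by rwa [hval])
      rw [hval] at this
      have hcg : c g ≤ c (swap j h) + c (swap j h * g) := by
        simpa using hmul (swap j h) (swap j h * g)
      linarith

/-! ### Poincaré inequality for permutations with lists -/

section ListPerms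

open Equiv

variable {ι : Type} [Fintype ι] [DecidableEq ι] {t : ℕ}

/-- The permutations whose values at the points `e i` are taken from the lists `L i`. -/
def listPerms (e : Fin t ↪ ι) (L : Fin t → Finset ι) : Finset (Perm ι) :=
  Finset.univ.filter fun σ => ∀ i, σ (e i) ∈ L i

/-- The permutations that fix all the points `e i`. -/
def fixingPerms (e : Fin t ↪ ι) : Finset (Perm ι) :=
  Finset.univ.filter fun g => ∀ i, g (e i) = e i

theorem mem_listPerms {e : Fin t ↪ ι} {L : Fin t → Finset ι} {σ : Perm ι} :
    σ ∈ listPerms e L ↔ ∀ i, σ (e i) ∈ L i := by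
  simp [listPerms]

theorem mem_fixingPerms {e : Fin t ↪ ι} {g : Perm ι} :
    g ∈ fixingPerms e ↔ ∀ i, g (e i) = e i := by
  simp [fixingPerms]

theorem mul_mem_listPerms_iff {e : Fin t ↪ ι} {L : Fin t → Finset ι} {σ g : Perm ι}
    (hg : ∀ i, g (e i) = e i) : σ * g ∈ listPerms e L ↔ σ ∈ listPerms e L := by
  simp [mem_listPerms, hg]

theorem comp_mem_cliqueColourings {e : Fin t ↪ ι} {L : Fin t → Finset ι} {σ : Perm ι} :
    σ ∘ e ∈ cliqueColourings L ↔ σ ∈ listPerms e L := by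
  simp [mem_cliqueColourings, mem_listPerms, σ.injective.comp e.injective]

theorem card_fixingPerms_pos (e : Fin t ↪ ι) : (0 : ℝ) < (fixingPerms e).card := by
  exact_mod_cast Finset.card_pos.2 ⟨1, by simp [mem_fixingPerms]⟩

theorem exists_perm_comp_eq {ι : Type*} {t : ℕ} (e : Fin t ↪ ι) {a : Fin t → ι} (ha : Function.Injective a) :
    ∃ σ : Perm ι, σ ∘ e = a := by
  obtain ⟨σ, hσ⟩ := (Perm.isMultiplyPretransitive ι t).exists_smul_eq e ⟨a, ha⟩
  exact ⟨σ, funext fun i => by simpa using DFunLike.congr_fun hσ i⟩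

/-- The fibre through `σ₀` is the coset `σ₀ * fixingPerms e`. -/
theorem sum_fiber_eq (e : Fin t ↪ ι) {L : Fin t → Finset ι} {σ₀ : Perm ι}
    (hσ₀ : σ₀ ∈ listPerms e L) (G : Perm ι → ℝ) :
    ∑ σ ∈ (listPerms e L).filter (fun σ : Perm ι => σ ∘ e = σ₀ ∘ e), G σ = ∑ g ∈ fixingPerms e, G (σ₀ * g) := by
  refine Finset.sum_bij' (fun σ _ => σ₀⁻¹ * σ) (fun g _ => σ₀ * g) ?_ ?_ ?_ ?_ ?_
  · intro σ hσ
    simp only [Finset.mem_filter] at hσ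
    rw [mem_fixingPerms]
    intro i
    have := congrFun hσ.2 i
    simp only [Function.comp_apply] at this
    simp [this]
  · intro g hg
    rw [mem_fixingPerms] at hg
    rw [Finset.mem_filter, mul_mem_listPerms_iff hg]
    exact ⟨hσ₀, funext fun i => by simp [hg i]⟩
  · intro σ _
    simp
  · intro g _
    simp
  · intro σ _
    simp

theorem sum_listPerms_comp (e : Fin t ↪ ι) (L : Fin t → Finset ι) (G : (Fin t → ι) → ℝ) :
    ∑ σ ∈ listPerms e L, G (σ ∘ e) = (fixingPerms e).card * ∑ a ∈ cliqueColourings L, G a := by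
  rw [← Finset.sum_fiberwise_of_maps_to (g := fun σ : Perm ι => σ ∘ e)
    (t := cliqueColourings L) fun σ hσ => comp_mem_cliqueColourings.2 hσ, Finset.mul_sum]
  refine Finset.sum_congr rfl fun a ha => ?_
  obtain ⟨σ₀, rfl⟩ := exists_perm_comp_eq e (mem_cliqueColourings.1 ha).2
  rw [sum_fiber_eq e (comp_mem_cliqueColourings.1 ha),
    Finset.sum_congr rfl fun g hg => by
      rw [show (σ₀ * g : Perm ι) ∘ e = σ₀ ∘ e from
        funext fun i => by simp [mem_fixingPerms.1 hg i]]]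
  simp

theorem card_listPerms (e : Fin t ↪ ι) (L : Fin t → Finset ι) :
    ((listPerms e L).card : ℝ) = (fixingPerms e).card * (cliqueColourings L).card := by
  simpa using sum_listPerms_comp e L fun _ => 1

/-- The Dirichlet form of the right multiplication by `g` on the permutations with lists `L`. -/
def permDirichlet (e : Fin t ↪ ι) (L : Fin t → Finset ι) (f : Perm ι → ℝ) (g : Perm ι) : ℝ :=
  ∑ σ, if σ ∈ listPerms e L ∧ σ * g ∈ listPerms e L then (f σ - f (σ * g)) ^ 2 else 0

theorem permDirichlet_nonneg (e : Fin t ↪ ι) (L : Fin t → Finset ι) (f : Perm ι → ℝ)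
    (g : Perm ι) : 0 ≤ permDirichlet e L f g :=
  Finset.sum_nonneg fun _ _ => by split_ifs <;> positivity

theorem permDirichlet_of_fixing {e : Fin t ↪ ι} (L : Fin t → Finset ι) (f : Perm ι → ℝ)
    {g : Perm ι} (hg : ∀ i, g (e i) = e i) :
    permDirichlet e L f g = ∑ σ ∈ listPerms e L, (f σ - f (σ * g)) ^ 2 := by
  simp_rw [permDirichlet, mul_mem_listPerms_iff hg, and_self]
  rw [← Finset.sum_filter]
  congr 1
  ext
  simp

theorem swap_apply_embedding {ι : Type*} [DecidableEq ι] {t : ℕ} {e : Fin t ↪ ι} {j k : ι} (hj : j ∉ Set.range e)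
    (hk : k ∉ Set.range e) (i : Fin t) : swap j k (e i) = e i :=
  swap_apply_of_ne_of_ne (fun h => hj ⟨i, h⟩) fun h => hk ⟨i, h⟩

/-- Conjugation writes `swap (e i) j` as `swap j h * swap (e i) h * swap j h`. The outer factors do
not touch constrained positions, so the intermediate permutations still respect the lists. -/
theorem permDirichlet_swap_le {e : Fin t ↪ ι} (L : Fin t → Finset ι) (f : Perm ι → ℝ) {h j : ι}
    (hh : h ∉ Set.range e) (hj : j ∉ Set.range e) (i : Fin t) :
    permDirichlet e L f (swap (e i) j) ≤
      3 * (permDirichlet e L f (swap j h) + permDirichlet e L f (swap (e i) h) +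
        permDirichlet e L f (swap j h)) := by
  have hij : e i ≠ j := fun h => hj ⟨i, h⟩
  have hih : e i ≠ h := fun h' => hh ⟨i, h'⟩
  have hfix := swap_apply_embedding hj hh
  have hconj : swap (e i) j = swap j h * swap (e i) h * swap j h := by
    rw [swap_comm j h, swap_mul_swap_mul_swap hih hij, swap_comm]
  -- Reindexing by right translations makes all three legs refer to the same starting `σ`; the last
  -- leg is traversed backwards.
  have e2 : permDirichlet e L f (swap (e i) h) = ∑ σ : Perm ι,
      if σ * swap j h ∈ listPerms e L ∧ σ * swap j h * swap (e i) h ∈ listPerms e L then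
        (f (σ * swap j h) - f (σ * swap j h * swap (e i) h)) ^ 2 else 0 :=
    (Equiv.sum_comp (Equiv.mulRight (swap j h)) _).symm
  have e3 : permDirichlet e L f (swap j h) = ∑ σ : Perm ι,
      if σ * swap (e i) j ∈ listPerms e L ∧ σ * swap (e i) j * swap j h ∈ listPerms e L then
        (f (σ * swap (e i) j) - f (σ * swap (e i) j * swap j h)) ^ 2 else 0 :=
    (Equiv.sum_comp (Equiv.mulRight (swap (e i) j)) _).symm
  nth_rw 2 [e3]
  rw [e2]
  simp_rw [permDirichlet]
  rw [← Finset.sum_add_distrib, ← Finset.sum_add_distrib, Finset.mul_sum]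
  refine Finset.sum_le_sum fun σ _ => ?_
  have hback : σ * swap (e i) j * swap j h = σ * swap j h * swap (e i) h := by
    rw [hconj]
    simp [mul_assoc]
  rw [hback]
  by_cases hσ : σ ∈ listPerms e L ∧ σ * swap (e i) j ∈ listPerms e L
  · have h1 : σ * swap j h ∈ listPerms e L := (mul_mem_listPerms_iff hfix).2 hσ.1
    have h2 : σ * swap j h * swap (e i) h ∈ listPerms e L := by
      rw [← hback]
      exact (mul_mem_listPerms_iff hfix).2 hσ.2
    simp only [hσ, h1, h2, and_self, if_true]
    refine (sq_sub_le_three_mul _ (f (σ * swap j h)) (f (σ * swap j h * swap (e i) h)) _).trans_eq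
      ?_
    ring
  · rw [if_neg hσ]
    refine mul_nonneg (by norm_num) (add_nonneg (add_nonneg ?_ ?_) ?_) <;> split_ifs <;> positivity

/-- For `g` fixing the constrained positions, `√(permDirichlet e L f g)` is the norm of the
difference between a function and its right translate by `g`. Translation is an isometry, so this
norm is subadditive in `g`. -/
theorem permDirichlet_le_of_fixing {e : Fin t ↪ ι} (L : Fin t → Finset ι) (f : Perm ι → ℝ) {h : ι}
    (hh : h ∉ Set.range e) {g : Perm ι} (hg : ∀ i, g (e i) = e i) :
    permDirichlet e L f g ≤
      4 * (∑ j with j ∉ Set.range e ∧ j ≠ h, √(permDirichlet e L f (swap j h))) ^ 2 := by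
  -- Permutations fixing the constrained positions preserve `listPerms e L`, so extending by 0 adds
  -- nothing to their Dirichlet forms, while `f'` can be translated by any permutation.
  set f' : Perm ι → ℝ := fun σ => if σ ∈ listPerms e L then f σ else 0 with hf'
  set v : Perm ι → EuclideanSpace ℝ (Perm ι) := fun g => WithLp.toLp 2 fun σ => f' σ - f' (σ * g)
  have hnorm : ∀ g : Perm ι, (∀ i, g (e i) = e i) → ‖v g‖ = √(permDirichlet e L f g) := by
    intro g hg
    rw [EuclideanSpace.norm_eq, permDirichlet]
    congr 1
    refine Finset.sum_congr rfl fun σ _ => ?_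
    simp only [v, hf', mul_mem_listPerms_iff hg, and_self, Real.norm_eq_abs, sq_abs]
    split_ifs <;> simp
  have hmul : ∀ g g', ‖v (g * g')‖ ≤ ‖v g‖ + ‖v g'‖ := by
    intro g g'
    set w : EuclideanSpace ℝ (Perm ι) := WithLp.toLp 2 fun σ => f' (σ * g) - f' (σ * g * g')
    have hw : ‖w‖ = ‖v g'‖ := by
      rw [EuclideanSpace.norm_eq, EuclideanSpace.norm_eq]
      congr 1
      exact Equiv.sum_comp (Equiv.mulRight g) fun σ => ‖f' σ - f' (σ * g')‖ ^ 2
    have hadd : v (g * g') = v g + w := by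
      ext σ
      simp [v, w, mul_assoc]
    rw [hadd, ← hw]
    exact norm_add_le _ _
  have hone : ‖v 1‖ = 0 := by
    rw [norm_eq_zero]
    ext σ
    simp [v]
  have key := le_two_mul_sum_swap h (fun g => ‖v g‖) hone (fun _ => norm_nonneg _) hmul
    (Finset.univ.filter fun j => j ∉ Set.range e ∧ j ≠ h) g (by
      intro x hx hxh
      have : x ∈ Set.range e := by
        by_contra hx'
        exact hx (by simp [hxh]; simpa using hx')
      obtain ⟨i, rfl⟩ := this
      exact hg i)
  have hsum : ∑ j with j ∉ Set.range e ∧ j ≠ h, ‖v (swap j h)‖ =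
      ∑ j with j ∉ Set.range e ∧ j ≠ h, √(permDirichlet e L f (swap j h)) :=
    Finset.sum_congr rfl fun j hj =>
      hnorm _ (swap_apply_embedding (Finset.mem_filter.1 hj).2.1 hh)
  rw [hsum, hnorm g hg] at key
  rw [← Real.sq_sqrt (permDirichlet_nonneg e L f g)]
  calc _ ≤ _ := pow_le_pow_left₀ (Real.sqrt_nonneg _) key 2
    _ = _ := by ring

/-- The average of `f` over the permutations with lists `L` and with given values at `e i`. -/
noncomputable def fiberAverage (e : Fin t ↪ ι) (L : Fin t → Finset ι) (f : Perm ι → ℝ)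
    (a : Fin t → ι) : ℝ :=
  (∑ σ ∈ (listPerms e L).filter (fun σ : Perm ι => σ ∘ e = a), f σ) / (fixingPerms e).card

theorem card_mul_fiberAverage {e : Fin t ↪ ι} {L : Fin t → Finset ι} (f : Perm ι → ℝ)
    {σ : Perm ι} (hσ : σ ∈ listPerms e L) :
    (fixingPerms e).card * fiberAverage e L f (σ ∘ e) = ∑ g ∈ fixingPerms e, f (σ * g) := by
  rw [fiberAverage, sum_fiber_eq e hσ, mul_div_cancel₀ _ (card_fixingPerms_pos e).ne']

theorem sum_sq_sub_fiberAverage_le {e : Fin t ↪ ι} (L : Fin t → Finset ι) (f : Perm ι → ℝ) {h : ι}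
    (hh : h ∉ Set.range e) :
    ∑ σ ∈ listPerms e L, (f σ - fiberAverage e L f (σ ∘ e)) ^ 2 ≤
      4 * (∑ j with j ∉ Set.range e ∧ j ≠ h, √(permDirichlet e L f (swap j h))) ^ 2 := by
  set N : ℝ := ((fixingPerms e).card : ℝ) with hN
  have hN0 : 0 < N := card_fixingPerms_pos e
  have hpt : ∀ σ ∈ listPerms e L, N * (f σ - fiberAverage e L f (σ ∘ e)) ^ 2 ≤
      ∑ g ∈ fixingPerms e, (f σ - f (σ * g)) ^ 2 := by
    intro σ hσ
    have h1 : N * (f σ - fiberAverage e L f (σ ∘ e)) =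
        ∑ g ∈ fixingPerms e, (f σ - f (σ * g)) := by
      rw [mul_sub, card_mul_fiberAverage f hσ, Finset.sum_sub_distrib]
      simp [hN]
    have h2 := sq_sum_le_card_mul_sum_sq (s := fixingPerms e) (f := fun g => f σ - f (σ * g))
    rw [← h1, ← hN] at h2
    refine le_of_mul_le_mul_left ?_ hN0
    linarith
  refine le_of_mul_le_mul_left ?_ hN0
  calc N * ∑ σ ∈ listPerms e L, (f σ - fiberAverage e L f (σ ∘ e)) ^ 2
      ≤ ∑ σ ∈ listPerms e L, ∑ g ∈ fixingPerms e, (f σ - f (σ * g)) ^ 2 := by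
        rw [Finset.mul_sum]
        exact Finset.sum_le_sum hpt
    _ = ∑ g ∈ fixingPerms e, permDirichlet e L f g := by
        rw [Finset.sum_comm]
        exact Finset.sum_congr rfl fun g hg =>
          (permDirichlet_of_fixing L f (mem_fixingPerms.1 hg)).symm
    _ ≤ (fixingPerms e).card • _ := Finset.sum_le_card_nsmul _ _ _ fun g hg =>
        permDirichlet_le_of_fixing L f hh (mem_fixingPerms.1 hg)
    _ = _ := by rw [nsmul_eq_mul]

theorem swap_mul_comp_eq_update {ι : Type*} [DecidableEq ι] {t : ℕ} {e : Fin t ↪ ι} {σ : Perm ι} {i : Fin t} {c : ι}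
    (hinj : Function.Injective (Function.update (σ ∘ e) i c)) :
    (swap (σ (e i)) c * σ : Perm ι) ∘ e = Function.update (σ ∘ e) i c := by
  funext k
  by_cases hk : k = i
  · simp [hk]
  · have h1 : σ (e k) ≠ σ (e i) := fun h => hk (e.injective (σ.injective h))
    have h2 : σ (e k) ≠ c := fun h => hk (hinj (by simp [hk, h]))
    simp [hk, swap_apply_of_ne_of_ne h1 h2]

/-- Exchanging the two colours `a i` and `c` by left multiplication maps the fibre over `a` onto the
fibre over the recoloured tuple. Cauchy–Schwarz is applied to this matching. -/
theorem sq_sub_fiberAverage_update_le {e : Fin t ↪ ι} {L : Fin t → Finset ι} (f : Perm ι → ℝ)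
    {a : Fin t → ι} (ha : a ∈ cliqueColourings L) {i : Fin t} {c : ι}
    (hac : Function.update a i c ∈ cliqueColourings L) :
    (fixingPerms e).card *
        (fiberAverage e L f a - fiberAverage e L f (Function.update a i c)) ^ 2 ≤
      ∑ σ ∈ (listPerms e L).filter (fun σ : Perm ι => σ ∘ e = a),
        (f σ - f (swap (σ (e i)) c * σ)) ^ 2 := by
  obtain ⟨σ, rfl⟩ := exists_perm_comp_eq e (mem_cliqueColourings.1 ha).2
  have hσ := comp_mem_cliqueColourings.1 ha
  have hup := swap_mul_comp_eq_update (mem_cliqueColourings.1 hac).2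
  rw [← hup] at hac ⊢
  have hσ' := comp_mem_cliqueColourings.1 hac
  rw [sum_fiber_eq e hσ]
  set N : ℝ := ((fixingPerms e).card : ℝ) with hN
  have hN0 : 0 < N := card_fixingPerms_pos e
  have h1 : N * (fiberAverage e L f (σ ∘ e) -
      fiberAverage e L f ((swap (σ (e i)) c * σ : Perm ι) ∘ e)) =
      ∑ g ∈ fixingPerms e, (f (σ * g) - f (swap ((σ * g) (e i)) c * (σ * g))) := by
    rw [mul_sub, card_mul_fiberAverage f hσ, card_mul_fiberAverage f hσ', Finset.sum_sub_distrib]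
    congr 1
    refine Finset.sum_congr rfl fun g hg => ?_
    rw [Perm.mul_apply, mem_fixingPerms.1 hg i, mul_assoc]
  have h2 := sq_sum_le_card_mul_sum_sq (s := fixingPerms e)
    (f := fun g => f (σ * g) - f (swap ((σ * g) (e i)) c * (σ * g)))
  rw [← h1, ← hN] at h2
  refine le_of_mul_le_mul_left ?_ hN0
  linarith

/-- Exchanging colours on the left is exchanging positions on the right: with `c = σ j`, the sum
over new colours becomes a sum over positions `j`. -/
theorem card_mul_cliqueDirichlet_fiberAverage_le (e : Fin t ↪ ι) (L : Fin t → Finset ι)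
    (f : Perm ι → ℝ) (i : Fin t) :
    (fixingPerms e).card * cliqueDirichlet L (fiberAverage e L f) i ≤
      ∑ j with j ∉ Set.range e, permDirichlet e L f (swap (e i) j) := by
  calc (fixingPerms e).card * cliqueDirichlet L (fiberAverage e L f) i
      ≤ ∑ a ∈ cliqueColourings L,
          ∑ σ ∈ (listPerms e L).filter (fun σ : Perm ι => σ ∘ e = a), ∑ c ∈ L i,
            if Function.update (σ ∘ e) i c ∈ cliqueColourings L then
              (f σ - f (swap (σ (e i)) c * σ)) ^ 2 else 0 := by
        rw [cliqueDirichlet, Finset.mul_sum]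
        refine Finset.sum_le_sum fun a ha => ?_
        rw [Finset.mul_sum, Finset.sum_comm]
        refine Finset.sum_le_sum fun c _ => ?_
        split_ifs with hac
        · refine (sq_sub_fiberAverage_update_le f ha hac).trans_eq ?_
          refine Finset.sum_congr rfl fun σ hσ => ?_
          rw [(Finset.mem_filter.1 hσ).2, if_pos hac]
        · rw [mul_zero]
          exact Finset.sum_nonneg fun _ _ => by split_ifs <;> positivity
    _ = ∑ σ ∈ listPerms e L, ∑ c ∈ L i,
          if Function.update (σ ∘ e) i c ∈ cliqueColourings L then
            (f σ - f (swap (σ (e i)) c * σ)) ^ 2 else 0 :=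
        Finset.sum_fiberwise_of_maps_to (fun σ hσ => comp_mem_cliqueColourings.2 hσ) _
    _ ≤ ∑ σ ∈ listPerms e L, ∑ j with j ∉ Set.range e,
          if σ * swap (e i) j ∈ listPerms e L then (f σ - f (σ * swap (e i) j)) ^ 2 else 0 := by
        refine Finset.sum_le_sum fun σ hσ => ?_
        calc _ ≤ ∑ c, if Function.update (σ ∘ e) i c ∈ cliqueColourings L then
                (f σ - f (swap (σ (e i)) c * σ)) ^ 2 else 0 :=
              Finset.sum_le_sum_of_subset_of_nonneg (Finset.subset_univ _)
                fun _ _ _ => by split_ifs <;> positivity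
          _ = ∑ j, if Function.update (σ ∘ e) i (σ j) ∈ cliqueColourings L then
                (f σ - f (σ * swap (e i) j)) ^ 2 else 0 := by
              rw [← Equiv.sum_comp σ]
              simp_rw [mul_swap_eq_swap_mul]
          _ ≤ ∑ j, if j ∉ Set.range e then
                (if σ * swap (e i) j ∈ listPerms e L then (f σ - f (σ * swap (e i) j)) ^ 2 else 0)
                else 0 := by
              refine Finset.sum_le_sum fun j _ => ?_
              by_cases h1 : Function.update (σ ∘ e) i (σ j) ∈ cliqueColourings L
              · rw [if_pos h1]
                -- A constrained `j` contributes nothing: `j = e i` does not move `σ`, and any other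
                -- one would repeat a colour.
                by_cases h2 : j ∈ Set.range e
                · obtain ⟨k, rfl⟩ := h2
                  by_cases hk : k = i
                  · simp [hk, swap_self, ← Perm.one_def]
                  · refine absurd ((mem_cliqueColourings.1 h1).2 (a₁ := i) (a₂ := k) ?_)
                      (Ne.symm hk)
                    simp [hk]
                · have h3 : σ * swap (e i) j ∈ listPerms e L := by
                    rw [← comp_mem_cliqueColourings, mul_swap_eq_swap_mul,
                      swap_mul_comp_eq_update (mem_cliqueColourings.1 h1).2]
                    exact h1
                  rw [if_pos h2, if_pos h3]
              · rw [if_neg h1]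
                split_ifs <;> positivity
          _ = _ := by rw [Finset.sum_filter]
    _ = _ := by
        rw [Finset.sum_comm]
        refine Finset.sum_congr rfl fun j _ => ?_
        rw [permDirichlet]
        simp_rw [ite_and]
        rw [Finset.sum_ite_mem, Finset.univ_inter]

theorem sum_permDirichlet_swap_le {e : Fin t ↪ ι} (L : Fin t → Finset ι) (f : Perm ι → ℝ) {h : ι}
    (hh : h ∉ Set.range e) (i : Fin t) :
    ∑ j with j ∉ Set.range e, permDirichlet e L f (swap (e i) j) ≤
      6 * (∑ j with j ∉ Set.range e ∧ j ≠ h, √(permDirichlet e L f (swap j h))) ^ 2 +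
        3 * (Fintype.card ι * permDirichlet e L f (swap (e i) h)) := by
  have hself : permDirichlet e L f (swap h h) = 0 := by
    simp [permDirichlet, swap_self, ← Perm.one_def]
  calc _ ≤ ∑ j with j ∉ Set.range e, (6 * permDirichlet e L f (swap j h) +
          3 * permDirichlet e L f (swap (e i) h)) := by
        refine Finset.sum_le_sum fun j hj => ?_
        have := permDirichlet_swap_le L f hh (Finset.mem_filter.1 hj).2 i
        linarith
    _ ≤ _ := by
        rw [Finset.sum_add_distrib, ← Finset.mul_sum, Finset.sum_const, nsmul_eq_mul]
        have h0 := permDirichlet_nonneg e L f (swap (e i) h)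
        refine add_le_add (mul_le_mul_of_nonneg_left ?_ (by norm_num)) ?_
        · rw [← Finset.sum_filter_of_ne (p := fun j => j ≠ h), Finset.filter_filter]
          · calc _ = ∑ j with j ∉ Set.range e ∧ j ≠ h,
                  √(permDirichlet e L f (swap j h)) ^ 2 :=
                  Finset.sum_congr rfl fun j _ =>
                    (Real.sq_sqrt (permDirichlet_nonneg e L f _)).symm
              _ ≤ _ := Finset.sum_sq_le_sq_sum_of_nonneg fun _ _ => Real.sqrt_nonneg _
          · rintro j _ hj rfl
            exact hj hself
        · have hc : ((Finset.univ.filter fun j => j ∉ Set.range e).card : ℝ) ≤ Fintype.card ι := by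
            exact_mod_cast Finset.card_le_univ _
          nlinarith

/-- The Poincaré inequality for the permutations with lists `L` and the transpositions with `h`. -/
theorem listPerms_poincare (t : ℕ) :
    ∃ C : ℝ, 0 < C ∧ ∀ (ι : Type) [Fintype ι] [DecidableEq ι] (e : Fin t ↪ ι)
      (L : Fin t → Finset ι), (∀ i, t + 1 ≤ (L i).card) → ∀ h : ι, h ∉ Set.range e →
      ∀ f : Perm ι → ℝ,
        ∑ σ ∈ listPerms e L, ∑ η ∈ listPerms e L, (f σ - f η) ^ 2 ≤
          C * (listPerms e L).card *
            (Fintype.card ι * ∑ i, permDirichlet e L f (swap (e i) h) +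
              (∑ j with j ∉ Set.range e ∧ j ≠ h, √(permDirichlet e L f (swap j h))) ^ 2) := by
  obtain ⟨C, hC, hpoin⟩ := cliqueColourings_poincare t
  -- The number 24 is `3 * (4 + 4)`, from the two legs inside fibres. The rest is the middle leg,
  -- where `t ^ t` compares the product of the list sizes with the number of colourings.
  refine ⟨24 + 3 * C * t ^ t * (3 + 6 * t), by positivity, fun ι _ _ e L hL h hh f => ?_⟩
  set X := listPerms e L with hX
  set S := (∑ j with j ∉ Set.range e ∧ j ≠ h, √(permDirichlet e L f (swap j h))) ^ 2 with hS
  set D := Fintype.card ι * ∑ i, permDirichlet e L f (swap (e i) h) with hD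
  set F := fiberAverage e L f with hF
  set N : ℝ := ((fixingPerms e).card : ℝ) with hN
  have hN0 : 0 < N := card_fixingPerms_pos e
  have hS0 : 0 ≤ S := sq_nonneg _
  have hD0 : 0 ≤ D := mul_nonneg (Nat.cast_nonneg _)
    (Finset.sum_nonneg fun _ _ => permDirichlet_nonneg _ _ _ _)
  have hX0 : (0 : ℝ) ≤ X.card := Nat.cast_nonneg _
  have hfib : ∑ σ ∈ X, (f σ - F (σ ∘ e)) ^ 2 ≤ 4 * S := sum_sq_sub_fiberAverage_le L f hh
  have hfib' : ∑ σ ∈ X, (F (σ ∘ e) - f σ) ^ 2 ≤ 4 * S := by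
    simpa only [sub_sq_comm] using hfib
  have hcol : ∑ a ∈ cliqueColourings L, ∑ b ∈ cliqueColourings L, (F a - F b) ^ 2 ≤
      C * ∑ i, (t ^ t * (cliqueColourings L).card) * cliqueDirichlet L F i := by
    refine (hpoin ι L hL F).trans (mul_le_mul_of_nonneg_left (Finset.sum_le_sum fun i _ =>
      mul_le_mul_of_nonneg_right ?_ (cliqueDirichlet_nonneg _ _ _)) hC)
    -- Lists are nonempty, so restoring the omitted factor `|L i|` only increases the product.
    refine le_trans (Finset.prod_le_prod (fun _ _ => by split_ifs <;> positivity) fun k _ => ?_)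
      (prod_card_le_card_cliqueColourings le_rfl L fun k => (Nat.le_succ t).trans (hL k))
    have := hL k
    split_ifs
    · exact_mod_cast (by omega : 1 ≤ (L k).card)
    · exact le_rfl
  have hdir : ∑ i, N * cliqueDirichlet L F i ≤ (3 + 6 * t) * (D + S) := by
    calc ∑ i, N * cliqueDirichlet L F i
        ≤ ∑ i : Fin t, (6 * S + 3 * (Fintype.card ι * permDirichlet e L f (swap (e i) h))) :=
          Finset.sum_le_sum fun i _ =>
            (card_mul_cliqueDirichlet_fiberAverage_le e L f i).trans
              (sum_permDirichlet_swap_le L f hh i)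
      _ = 6 * t * S + 3 * D := by
          rw [Finset.sum_add_distrib, hD]
          simp [← Finset.mul_sum]
          ring
      _ ≤ _ := by nlinarith [mul_nonneg (Nat.cast_nonneg (α := ℝ) t) hD0]
  have hmid : ∑ σ ∈ X, ∑ η ∈ X, (F (σ ∘ e) - F (η ∘ e)) ^ 2 ≤
      C * t ^ t * X.card * ((3 + 6 * t) * (D + S)) := by
    calc _ = ∑ σ ∈ X, N * ∑ b ∈ cliqueColourings L, (F (σ ∘ e) - F b) ^ 2 :=
          Finset.sum_congr rfl fun σ _ => sum_listPerms_comp e L fun b => (F (σ ∘ e) - F b) ^ 2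
      -- Each sum over permutations gives a factor `N`: one combines with the number of colourings
      -- into `X.card`, the other is absorbed by the Dirichlet form of `F`.
      _ = N * (N * ∑ a ∈ cliqueColourings L, ∑ b ∈ cliqueColourings L, (F a - F b) ^ 2) := by
          rw [← Finset.mul_sum,
            sum_listPerms_comp e L fun a => ∑ b ∈ cliqueColourings L, (F a - F b) ^ 2]
      _ ≤ N * (N * (C * ∑ i, (t ^ t * (cliqueColourings L).card) * cliqueDirichlet L F i)) :=
          mul_le_mul_of_nonneg_left (mul_le_mul_of_nonneg_left hcol hN0.le) hN0.le
      _ = C * t ^ t * X.card * ∑ i, N * cliqueDirichlet L F i := by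
          rw [hX, card_listPerms, ← Finset.mul_sum, ← Finset.mul_sum]
          ring
      _ ≤ _ := mul_le_mul_of_nonneg_left hdir (by positivity)
  calc ∑ σ ∈ X, ∑ η ∈ X, (f σ - f η) ^ 2
      ≤ ∑ σ ∈ X, ∑ η ∈ X, 3 * ((f σ - F (σ ∘ e)) ^ 2 + (F (σ ∘ e) - F (η ∘ e)) ^ 2 +
          (F (η ∘ e) - f η) ^ 2) :=
        Finset.sum_le_sum fun σ _ => Finset.sum_le_sum fun η _ => sq_sub_le_three_mul _ _ _ _
    _ = 3 * (X.card * ∑ σ ∈ X, (f σ - F (σ ∘ e)) ^ 2 +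
          ∑ σ ∈ X, ∑ η ∈ X, (F (σ ∘ e) - F (η ∘ e)) ^ 2 +
          X.card * ∑ σ ∈ X, (F (σ ∘ e) - f σ) ^ 2) := by
        simp only [← Finset.mul_sum, Finset.sum_add_distrib, Finset.sum_const, nsmul_eq_mul]
    _ ≤ 3 * (X.card * (4 * S) + C * t ^ t * X.card * ((3 + 6 * t) * (D + S)) +
          X.card * (4 * S)) :=
        mul_le_mul_of_nonneg_left (add_le_add (add_le_add
          (mul_le_mul_of_nonneg_left hfib hX0) hmid)
          (mul_le_mul_of_nonneg_left hfib' hX0)) (by norm_num)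
    _ = 24 * (X.card * S) + 3 * C * t ^ t * (3 + 6 * t) * X.card * (D + S) := by ring
    _ ≤ _ := by nlinarith [mul_nonneg hX0 hD0]

end ListPerms

/-! ### From a Poincaré inequality to the spectral gap and irreducibility -/

open Matrix in
/-- If a symmetric matrix satisfies a Rayleigh bound on the vectors of mean zero, then its second
smallest eigenvalue is bounded from below. -/
theorem le_spectralGap {Ω : Type*} [Fintype Ω] {Q : Matrix Ω Ω ℝ} (hQ : Q.IsSymm) {r : ℝ}
    (hcard : 2 ≤ Fintype.card Ω)
    (hr : ∀ g : Ω → ℝ, ∑ x, g x = 0 → r * ∑ x, g x ^ 2 ≤ g ⬝ᵥ ((-Q) *ᵥ g)) :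
    r ≤ spectralGap Q := by
  classical
  have hA : (-Q).IsHermitian := by
    rw [Matrix.IsHermitian, Matrix.conjTranspose_eq_transpose_of_trivial, Matrix.transpose_neg, hQ]
  have hroots : (-Q).charpoly.roots = Finset.univ.val.map hA.eigenvalues := by
    simpa using hA.roots_charpoly_eq_eigenvalues
  by_contra! hlt
  -- If the entry of index 1 is below `r`, so is the one of index 0. As there are at least two
  -- states, the default value of `getD` is not used.
  obtain ⟨i, j, hij, hi, hj⟩ :
      ∃ i j, i ≠ j ∧ hA.eigenvalues i < r ∧ hA.eigenvalues j < r := by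
    have hlen : ((-Q).charpoly.roots.sort (· ≤ ·)).length = Fintype.card Ω := by
      rw [Multiset.length_sort, hroots]
      simp
    have hsorted : ((-Q).charpoly.roots.sort (· ≤ ·)).Pairwise (· ≤ ·) :=
      Multiset.pairwise_sort _ _
    have hcoe : (((-Q).charpoly.roots.sort (· ≤ ·) : List ℝ) : Multiset ℝ) =
        Finset.univ.val.map hA.eigenvalues := by
      rw [Multiset.sort_eq, hroots]
    have hlt' : ((-Q).charpoly.roots.sort (· ≤ ·)).getD 1 0 < r := by
      unfold spectralGap at hlt
      exact hlt
    generalize (-Q).charpoly.roots.sort (· ≤ ·) = l at hlen hsorted hcoe hlt'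
    match l, hlen, hsorted, hcoe, hlt' with
    | [], hlen, _, _, _ => simp at hlen; omega
    | [a], hlen, _, _, _ => simp at hlen; omega
    | a :: b :: l, _, hsorted, hcoe, hlt' =>
      have hb : b < r := by simpa using hlt'
      have ha : a < r := lt_of_le_of_lt ((List.pairwise_cons.1 hsorted).1 b (by simp)) hb
      have h2 : 1 < (Finset.univ.filter fun i => hA.eigenvalues i < r).card := by
        have : Multiset.countP (· < r) (Finset.univ.val.map hA.eigenvalues) =
            (Finset.univ.filter fun i => hA.eigenvalues i < r).card := by
          rw [Multiset.countP_map]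
          rfl
        rw [← this, ← hcoe]
        simp [ha, hb]
      obtain ⟨i, hi, j, hj, hij⟩ := Finset.one_lt_card.1 h2
      exact ⟨i, j, hij, (Finset.mem_filter.1 hi).2, (Finset.mem_filter.1 hj).2⟩
  set u : Ω → ℝ := ⇑(hA.eigenvectorBasis i) with hu
  set v : Ω → ℝ := ⇑(hA.eigenvectorBasis j) with hv
  have hdot : ∀ k l, (hA.eigenvectorBasis k : Ω → ℝ) ⬝ᵥ ⇑(hA.eigenvectorBasis l) =
      if k = l then 1 else 0 := by
    intro k l
    rw [← orthonormal_iff_ite.1 hA.eigenvectorBasis.orthonormal k l,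
      EuclideanSpace.inner_eq_star_dotProduct, dotProduct_comm]
    simp
  have huu : u ⬝ᵥ u = 1 := by simp [hu, hdot]
  have hvv : v ⬝ᵥ v = 1 := by simp [hv, hdot]
  have huv : u ⬝ᵥ v = 0 := by simp [hu, hv, hdot, hij]
  have hvu : v ⬝ᵥ u = 0 := by rw [dotProduct_comm, huv]
  have hAu : (-Q) *ᵥ u = hA.eigenvalues i • u := hA.mulVec_eigenvectorBasis i
  have hAv : (-Q) *ᵥ v = hA.eigenvalues j • v := hA.mulVec_eigenvectorBasis j
  -- Two independent eigenvectors span a nonzero vector of mean zero, whose Rayleigh quotient is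
  -- still below `r`.
  obtain ⟨α, β, hne, hαβ⟩ : ∃ α β : ℝ, 0 < α ^ 2 + β ^ 2 ∧
      α * ∑ x, u x + β * ∑ x, v x = 0 := by
    by_cases hs : ∑ x, u x = 0
    · exact ⟨1, 0, by norm_num, by simp [hs]⟩
    · exact ⟨-∑ x, v x, ∑ x, u x, by positivity, by ring⟩
  have hg := hr (α • u + β • v) (by
    simpa [Finset.sum_add_distrib, ← Finset.mul_sum] using hαβ)
  have hsq : ∑ x, (α • u + β • v) x ^ 2 = α ^ 2 + β ^ 2 := by
    have : ∑ x, (α • u + β • v) x ^ 2 = (α • u + β • v) ⬝ᵥ (α • u + β • v) :=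
      Finset.sum_congr rfl fun x _ => sq _
    rw [this]
    simp only [add_dotProduct, dotProduct_add, smul_dotProduct, dotProduct_smul, huu, hvv, huv,
      hvu, smul_eq_mul]
    ring
  have hform : (α • u + β • v) ⬝ᵥ ((-Q) *ᵥ (α • u + β • v)) =
      α ^ 2 * hA.eigenvalues i + β ^ 2 * hA.eigenvalues j := by
    simp only [mulVec_add, mulVec_smul, hAu, hAv, add_dotProduct, dotProduct_add, smul_dotProduct,
      dotProduct_smul, huu, hvv, huv, hvu, smul_eq_mul]
    ring
  rw [hsq, hform] at hg
  nlinarith [sq_nonneg α, sq_nonneg β, mul_nonneg (sq_nonneg α) (sub_pos.2 hi).le,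
    mul_nonneg (sq_nonneg β) (sub_pos.2 hj).le, mul_pos hne (lt_min (sub_pos.2 hi) (sub_pos.2 hj)),
    mul_le_mul_of_nonneg_left (min_le_left (r - hA.eigenvalues i) (r - hA.eigenvalues j))
      (sq_nonneg α),
    mul_le_mul_of_nonneg_left (min_le_right (r - hA.eigenvalues i) (r - hA.eigenvalues j))
      (sq_nonneg β)]

open Matrix in
theorem dotProduct_neg_mulVec_eq {Ω : Type*} [Fintype Ω] {Q : Matrix Ω Ω ℝ} (hQ : Q.IsSymm)
    (hrow : ∀ x, ∑ y, Q x y = 0) (g : Ω → ℝ) :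
    ∑ x, ∑ y, Q x y * (g x - g y) ^ 2 = 2 * (g ⬝ᵥ ((-Q) *ᵥ g)) := by
  have hcol : ∀ y, ∑ x, Q x y = 0 := fun y => by
    rw [← hrow y]
    exact Finset.sum_congr rfl fun x _ => hQ.apply y x
  have h1 : ∑ x, ∑ y, Q x y * g x ^ 2 = 0 := by
    simp [← Finset.sum_mul, hrow]
  have h2 : ∑ x, ∑ y, Q x y * g y ^ 2 = 0 := by
    rw [Finset.sum_comm]
    simp [← Finset.sum_mul, hcol]
  have h3 : g ⬝ᵥ ((-Q) *ᵥ g) = -∑ x, ∑ y, g x * (Q x y * g y) := by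
    simp [dotProduct, mulVec, Finset.mul_sum]
  calc _ = ∑ x, ∑ y, Q x y * g x ^ 2 + ∑ x, ∑ y, Q x y * g y ^ 2 -
        2 * ∑ x, ∑ y, g x * (Q x y * g y) := by
        simp only [Finset.mul_sum, ← Finset.sum_add_distrib, ← Finset.sum_sub_distrib]
        exact Finset.sum_congr rfl fun x _ => Finset.sum_congr rfl fun y _ => by ring
    _ = _ := by
        rw [h1, h2, h3]
        ring

/-- If `y` were unreachable from `x`, the indicator of the states reachable from `x` would have a
nonpositive Dirichlet form without being constant. -/
theorem isErgodicGenerator_of_poincare {Ω : Type*} [Fintype Ω] {Q : Matrix Ω Ω ℝ} (hQ : Q.IsSymm)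
    {K : ℝ} (hK : 0 ≤ K)
    (hpoin : ∀ f : Ω → ℝ, ∑ x, ∑ y, (f x - f y) ^ 2 ≤ K * ∑ x, ∑ y, Q x y * (f x - f y) ^ 2) :
    IsErgodicGenerator Q := by
  classical
  intro x y
  by_contra hxy
  set R : Ω → Ω → Prop := fun a b => a ≠ b ∧ 0 < Q a b with hR
  set f : Ω → ℝ := fun z => if Relation.ReflTransGen R x z then 1 else 0 with hf
  have hleave : ∀ a b, Relation.ReflTransGen R x a → ¬Relation.ReflTransGen R x b →
      Q a b ≤ 0 := by
    intro a b ha hb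
    by_contra! hpos
    exact hb (ha.tail ⟨by rintro rfl; exact hb ha, hpos⟩)
  have hzero : ∑ a, ∑ b, Q a b * (f a - f b) ^ 2 ≤ 0 := by
    refine Finset.sum_nonpos fun a _ => Finset.sum_nonpos fun b _ => ?_
    by_cases ha : Relation.ReflTransGen R x a <;> by_cases hb : Relation.ReflTransGen R x b
    · simp [hf, ha, hb]
    · simpa [hf, ha, hb] using hleave a b ha hb
    · simpa [hf, ha, hb, hQ.apply] using hleave b a hb ha
    · simp [hf, ha, hb]
  have hle := (hpoin f).trans (mul_nonpos_of_nonneg_of_nonpos hK hzero)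
  have hx : f x = 1 := if_pos Relation.ReflTransGen.refl
  have hy : f y = 0 := if_neg hxy
  have h1 : (f x - f y) ^ 2 ≤ ∑ a, ∑ b, (f a - f b) ^ 2 :=
    (Finset.single_le_sum (f := fun b => (f x - f b) ^ 2) (fun _ _ => sq_nonneg _)
      (Finset.mem_univ y)).trans
    (Finset.single_le_sum (f := fun a => ∑ b, (f a - f b) ^ 2)
      (fun _ _ => Finset.sum_nonneg fun _ _ => sq_nonneg _) (Finset.mem_univ x))
  rw [hx, hy] at h1
  linarith

theorem inv_le_spectralGap_of_poincare {Ω : Type*} [Fintype Ω] {Q : Matrix Ω Ω ℝ} (hQ : Q.IsSymm)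
    (hrow : ∀ x, ∑ y, Q x y = 0) (hcard : 2 ≤ Fintype.card Ω) {K : ℝ} (hK : 0 < K)
    (hpoin : ∀ f : Ω → ℝ, ∑ x, ∑ y, (f x - f y) ^ 2 ≤
      K * Fintype.card Ω * ∑ x, ∑ y, Q x y * (f x - f y) ^ 2) :
    K⁻¹ ≤ spectralGap Q := by
  refine le_spectralGap hQ hcard fun g hg => ?_
  have hN : (0 : ℝ) < Fintype.card Ω := by exact_mod_cast (by omega : 0 < Fintype.card Ω)
  have h1 := hpoin g
  rw [dotProduct_neg_mulVec_eq hQ hrow] at h1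
  have h2 : ∑ x, ∑ y, (g x - g y) ^ 2 = 2 * Fintype.card Ω * ∑ x, g x ^ 2 := by
    have : ∀ x y, (g x - g y) ^ 2 = g x ^ 2 + g y ^ 2 - 2 * (g x * g y) := fun x y => by ring
    simp only [this, Finset.sum_sub_distrib, Finset.sum_add_distrib, ← Finset.mul_sum, hg,
      Finset.sum_const, Finset.card_univ, nsmul_eq_mul, mul_zero]
    ring
  rw [h2] at h1
  rw [inv_mul_le_iff₀ hK]
  refine le_of_mul_le_mul_left ?_ hN
  linarith

/-! ### Dirichlet form of the Glauber generator -/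

theorem glauberRate_comm {V : Type*} [Fintype V] {k : ℕ} (p : V → ℝ) (σ η : V → Fin k) :
    glauberRate p σ η = glauberRate p η σ := by
  unfold glauberRate
  refine Finset.sum_congr rfl fun v _ => ?_
  congr 1
  simp only [DifferOnlyAt, ne_comm, eq_comm]

theorem glauberGenerator_isSymm {V : Type*} [Fintype V] {k : ℕ} (G : SimpleGraph V)
    (L : V → Finset (Fin k)) (p : V → ℝ) : (glauberGenerator G L p).IsSymm := by
  refine Matrix.IsSymm.ext fun σ η => ?_
  by_cases h : σ = η
  · rw [h]
  · simp [glauberGenerator, h, Ne.symm h, glauberRate_comm p η.1]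

theorem sum_glauberGenerator {V : Type*} [Fintype V] {k : ℕ} (G : SimpleGraph V)
    (L : V → Finset (Fin k)) (p : V → ℝ) (σ : ListColouring G L) :
    ∑ η, glauberGenerator G L p σ η = 0 := by
  classical
  rw [← Finset.add_sum_erase _ _ (Finset.mem_univ σ)]
  rw [Finset.sum_congr rfl fun η hη => show glauberGenerator G L p σ η = glauberRate p σ.1 η.1 by
    simp [glauberGenerator, (Finset.ne_of_mem_erase hη).symm]]
  simp only [glauberGenerator, Matrix.of_apply, if_true]
  rw [neg_add_eq_zero]

open Classical in
theorem sum_glauberGenerator_mul_sq {V : Type*} [Fintype V] {k : ℕ} (G : SimpleGraph V)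
    (L : V → Finset (Fin k)) (p : V → ℝ) (f : ListColouring G L → ℝ) :
    ∑ σ, ∑ η, glauberGenerator G L p σ η * (f σ - f η) ^ 2 =
      ∑ v, p v * ∑ σ, ∑ η, if DifferOnlyAt σ.1 η.1 v then (f σ - f η) ^ 2 else 0 := by
  have h : ∀ σ η, glauberGenerator G L p σ η * (f σ - f η) ^ 2 =
      ∑ v, p v * if DifferOnlyAt σ.1 η.1 v then (f σ - f η) ^ 2 else 0 := by
    intro σ η
    by_cases hση : σ = η
    · simp [hση]
    · simp [glauberGenerator, hση, glauberRate, Finset.sum_mul]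
  simp_rw [h, Finset.mul_sum]
  rw [Finset.sum_comm (s := Finset.univ (α := V))]
  exact Finset.sum_congr rfl fun σ _ => Finset.sum_comm

/-! ### Colourings of the clique as permutations -/

section Clique

open Equiv

variable {d t : ℕ}

/-- The lists of the constrained vertices. -/
def constrainedLists (htd : t ≤ d) (L : Fin d → Finset (Fin (d + 1))) :
    Fin t → Finset (Fin (d + 1)) :=
  fun k => L (Fin.castLE htd k)

/-- The constrained vertices, as positions of a permutation of the colours. -/
def constrainedEmb (htd : t ≤ d) : Fin t ↪ Fin (d + 1) :=
  (Fin.castLEEmb htd).trans Fin.castSuccEmb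

theorem constrainedEmb_apply (htd : t ≤ d) (k : Fin t) :
    constrainedEmb htd k = (Fin.castLE htd k).castSucc := rfl

theorem last_notMem_range_constrainedEmb (htd : t ≤ d) :
    Fin.last d ∉ Set.range (constrainedEmb htd) := by
  rintro ⟨k, hk⟩
  exact (Fin.castSucc_lt_last _).ne hk

theorem castSucc_mem_range_constrainedEmb (htd : t ≤ d) (i : Fin d) :
    i.castSucc ∈ Set.range (constrainedEmb htd) ↔ i.val < t := by
  constructor
  · rintro ⟨k, hk⟩
    rw [constrainedEmb_apply, Fin.castSucc_inj] at hk
    rw [← hk]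
    exact k.isLt
  · exact fun hi => ⟨⟨i, hi⟩, rfl⟩

theorem IsFeasible.le {L : Fin d → Finset (Fin (d + 1))} (hd : 1 ≤ d) (hL : IsFeasible t L) :
    t ≤ d := by
  by_contra! h
  have h1 := hL.constrained ⟨0, hd⟩ (by simp; omega)
  have h2 := Finset.card_le_univ (L ⟨0, hd⟩)
  rw [Fintype.card_fin] at h2
  omega

/-- If the last vertex is constrained then `t = d`, and `t + 1` colours are already all of them. -/
theorem IsFeasible.eq_univ_of_last {L : Fin d → Finset (Fin (d + 1))} (hL : IsFeasible t L) {i : Fin d}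
    (hi : i.val + 1 = d) : L i = Finset.univ := by
  rw [← Finset.card_eq_iff_eq_univ, Fintype.card_fin]
  by_cases h : t ≤ i.val
  · exact hL.free i h
  · have h1 := hL.constrained i (by omega)
    have h2 := Finset.card_le_univ (L i)
    rw [Fintype.card_fin] at h2
    omega

theorem mem_listPerms_constrained {L : Fin d → Finset (Fin (d + 1))} (hL : IsFeasible t L)
    (htd : t ≤ d) {σ : Perm (Fin (d + 1))} :
    σ ∈ listPerms (constrainedEmb htd) (constrainedLists htd L) ↔
      ∀ i : Fin d, σ i.castSucc ∈ L i := by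
  rw [mem_listPerms]
  refine ⟨fun h i => ?_, fun h k => h _⟩
  by_cases hi : i.val < t
  · exact h ⟨i, hi⟩
  · rw [Finset.eq_univ_of_card (L i) (by rw [hL.free i (by omega), Fintype.card_fin])]
    exact Finset.mem_univ _

/-- The colouring given by a permutation; the value at the last position is the unused colour. -/
def colouringOfPerm {L : Fin d → Finset (Fin (d + 1))} (hL : IsFeasible t L) (htd : t ≤ d)
    (σ : {σ // σ ∈ listPerms (constrainedEmb htd) (constrainedLists htd L)}) :
    ListColouring (⊤ : SimpleGraph (Fin d)) L :=
  ⟨fun i => σ.1 i.castSucc, fun _ _ huv h => huv (Fin.castSucc_injective d (σ.1.injective h)),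
    (mem_listPerms_constrained hL htd).1 σ.2⟩

theorem colouringOfPerm_bijective {L : Fin d → Finset (Fin (d + 1))} (hL : IsFeasible t L)
    (htd : t ≤ d) : Function.Bijective (colouringOfPerm hL htd) := by
  constructor
  · rintro ⟨σ, hσ⟩ ⟨η, hη⟩ h
    have hagree : ∀ i : Fin d, σ i.castSucc = η i.castSucc := fun i =>
      congrFun (congrArg Subtype.val h) i
    refine Subtype.ext (Perm.ext fun x => ?_)
    induction x using Fin.lastCases with
    | cast i => exact hagree i
    | last =>
      obtain ⟨y, hy⟩ := η.surjective (σ (Fin.last d))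
      induction y using Fin.lastCases with
      | cast j =>
        rw [← hagree j] at hy
        exact absurd (σ.injective hy) (Fin.castSucc_lt_last j).ne
      | last => exact hy.symm
  · intro x
    have hinj : Function.Injective x.1 := fun u v huv => by
      by_contra hne
      exact x.2.1 u v hne huv
    obtain ⟨σ, hσ⟩ := exists_perm_comp_eq Fin.castSuccEmb hinj
    have hσ' : ∀ i : Fin d, σ i.castSucc = x.1 i := fun i => congrFun hσ i
    refine ⟨⟨σ, (mem_listPerms_constrained hL htd).2 fun i => ?_⟩, Subtype.ext (funext hσ')⟩
    rw [hσ']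
    exact x.2.2 i

/-- The colourings of the clique correspond to permutations of the colours. -/
noncomputable def permEquivColouring {L : Fin d → Finset (Fin (d + 1))} (hL : IsFeasible t L)
    (htd : t ≤ d) : {σ // σ ∈ listPerms (constrainedEmb htd) (constrainedLists htd L)} ≃
      ListColouring (⊤ : SimpleGraph (Fin d)) L :=
  Equiv.ofBijective _ (colouringOfPerm_bijective hL htd)

theorem permEquivColouring_apply {L : Fin d → Finset (Fin (d + 1))} (hL : IsFeasible t L)
    (htd : t ≤ d) (σ : {σ // σ ∈ listPerms (constrainedEmb htd) (constrainedLists htd L)})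
    (i : Fin d) : (permEquivColouring hL htd σ).1 i = σ.1 i.castSucc := rfl

theorem card_listColouring {L : Fin d → Finset (Fin (d + 1))} (hL : IsFeasible t L)
    (htd : t ≤ d) : Fintype.card (ListColouring (⊤ : SimpleGraph (Fin d)) L) =
      (listPerms (constrainedEmb htd) (constrainedLists htd L)).card := by
  rw [← Fintype.card_congr (permEquivColouring hL htd), Fintype.card_coe]

/-- Without a second state `spectralGap` would take its default value. One colouring comes from the
counting bound, and another from exchanging the colour of the last vertex, whose list is full, with
the unused colour. -/
theorem two_le_card_listColouring {L : Fin d → Finset (Fin (d + 1))} (hL : IsFeasible t L)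
    (hd : 1 ≤ d) : 2 ≤ Fintype.card (ListColouring (⊤ : SimpleGraph (Fin d)) L) := by
  have htd := hL.le hd
  rw [card_listColouring hL htd]
  obtain ⟨x, hx⟩ : (cliqueColourings (constrainedLists htd L)).Nonempty := by
    have hlist : ∀ k, t + 1 ≤ (constrainedLists htd L k).card := fun k =>
      hL.constrained _ k.isLt
    have h1 := prod_card_le_card_cliqueColourings le_rfl (constrainedLists htd L)
      fun k => (Nat.le_succ t).trans (hlist k)
    have h2 : (0 : ℝ) < ∏ k, ((constrainedLists htd L k).card : ℝ) :=
      Finset.prod_pos fun k _ => by exact_mod_cast (Nat.succ_pos t).trans_le (hlist k)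
    rw [← Finset.card_pos]
    by_contra h0
    rw [Nat.eq_zero_of_not_pos h0] at h1
    simp only [Nat.cast_zero, mul_zero] at h1
    linarith
  obtain ⟨σ, rfl⟩ := exists_perm_comp_eq (constrainedEmb htd) (mem_cliqueColourings.1 hx).2
  rw [comp_mem_cliqueColourings] at hx
  have hσ := (mem_listPerms_constrained hL htd).1 hx
  set l : Fin d := ⟨d - 1, by omega⟩ with hl
  have hη : σ * swap l.castSucc (Fin.last d) ∈
      listPerms (constrainedEmb htd) (constrainedLists htd L) := by
    rw [mem_listPerms_constrained hL htd]
    intro i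
    by_cases hi : i = l
    · have : L i = Finset.univ := by
        have hil : i.val = d - 1 := by rw [hi]
        exact hL.eq_univ_of_last (by omega)
      rw [this]
      exact Finset.mem_univ _
    · rw [Perm.mul_apply, swap_apply_of_ne_of_ne (fun h => hi (Fin.castSucc_injective d h))
        (Fin.castSucc_lt_last i).ne]
      exact hσ i
  refine Finset.one_lt_card.2 ⟨σ, hx, _, hη, fun h => ?_⟩
  rw [left_eq_mul, swap_eq_one_iff] at h
  exact (Fin.castSucc_lt_last l).ne h

/-- A function of the colourings as a function of the permutations. -/
noncomputable def liftToPerm {L : Fin d → Finset (Fin (d + 1))} (hL : IsFeasible t L) (htd : t ≤ d)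
    (f : ListColouring (⊤ : SimpleGraph (Fin d)) L → ℝ) (σ : Perm (Fin (d + 1))) : ℝ :=
  if h : σ ∈ listPerms (constrainedEmb htd) (constrainedLists htd L) then
    f (permEquivColouring hL htd ⟨σ, h⟩) else 0

theorem liftToPerm_coe {L : Fin d → Finset (Fin (d + 1))} (hL : IsFeasible t L) (htd : t ≤ d)
    (f : ListColouring (⊤ : SimpleGraph (Fin d)) L → ℝ)
    (σ : {σ // σ ∈ listPerms (constrainedEmb htd) (constrainedLists htd L)}) :
    liftToPerm hL htd f σ = f (permEquivColouring hL htd σ) := by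
  simp [liftToPerm]

theorem sum_sq_sub_liftToPerm {L : Fin d → Finset (Fin (d + 1))} (hL : IsFeasible t L)
    (htd : t ≤ d) (f : ListColouring (⊤ : SimpleGraph (Fin d)) L → ℝ) :
    ∑ σ ∈ listPerms (constrainedEmb htd) (constrainedLists htd L),
      ∑ η ∈ listPerms (constrainedEmb htd) (constrainedLists htd L),
        (liftToPerm hL htd f σ - liftToPerm hL htd f η) ^ 2 = ∑ x, ∑ y, (f x - f y) ^ 2 := by
  rw [← Equiv.sum_comp (permEquivColouring hL htd), ← Finset.sum_coe_sort]
  refine Finset.sum_congr rfl fun σ _ => ?_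
  rw [← Equiv.sum_comp (permEquivColouring hL htd), ← Finset.sum_coe_sort]
  exact Finset.sum_congr rfl fun η _ => by rw [liftToPerm_coe, liftToPerm_coe]

-- Exchanging position `i` with the last one gives `u_i` the unused colour and changes no other
-- vertex.
open Classical in
theorem permDirichlet_liftToPerm_le {L : Fin d → Finset (Fin (d + 1))} (hL : IsFeasible t L)
    (htd : t ≤ d) (f : ListColouring (⊤ : SimpleGraph (Fin d)) L → ℝ) (i : Fin d) :
    permDirichlet (constrainedEmb htd) (constrainedLists htd L) (liftToPerm hL htd f)
        (swap i.castSucc (Fin.last d)) ≤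
      ∑ σ, ∑ η, if DifferOnlyAt σ.1 η.1 i then (f σ - f η) ^ 2 else 0 := by
  rw [permDirichlet]
  simp_rw [ite_and]
  rw [Finset.sum_ite_mem, Finset.univ_inter, ← Equiv.sum_comp (permEquivColouring hL htd),
    ← Finset.sum_coe_sort]
  refine Finset.sum_le_sum fun σ _ => ?_
  have hnonneg : ∀ η ∈ Finset.univ, 0 ≤ if DifferOnlyAt (permEquivColouring hL htd σ).1 η.1 i then
      (f (permEquivColouring hL htd σ) - f η) ^ 2 else 0 := fun _ _ => by
    split_ifs <;> positivity
  split_ifs with h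
  · set η := permEquivColouring hL htd ⟨_, h⟩ with hη
    have hdiff : DifferOnlyAt (permEquivColouring hL htd σ).1 η.1 i := by
      refine ⟨?_, fun u hu => ?_⟩
      · rw [hη, permEquivColouring_apply, permEquivColouring_apply, Perm.mul_apply,
          swap_apply_left]
        exact fun h' => (Fin.castSucc_lt_last i).ne (σ.1.injective h')
      · rw [hη, permEquivColouring_apply, permEquivColouring_apply, Perm.mul_apply,
          swap_apply_of_ne_of_ne (fun h => hu (Fin.castSucc_injective d h))
          (Fin.castSucc_lt_last u).ne]
    have := Finset.single_le_sum hnonneg (Finset.mem_univ η)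
    rw [if_pos hdiff] at this
    rw [liftToPerm_coe, liftToPerm_coe hL htd f ⟨_, h⟩]
    exact this
  · exact Finset.sum_nonneg hnonneg

theorem sum_constrainedEmb (htd : t ≤ d) (G : Fin (d + 1) → ℝ) :
    ∑ k, G (constrainedEmb htd k) = ∑ i : Fin d with i.val < t, G i.castSucc := by
  refine Finset.sum_bij (fun k _ => Fin.castLE htd k) (fun k _ => by simp) ?_ ?_ ?_
  · intro a _ b _ h
    exact Fin.castLE_injective htd h
  · intro i hi
    exact ⟨⟨i, (Finset.mem_filter.1 hi).2⟩, Finset.mem_univ _, rfl⟩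
  · exact fun k _ => rfl

theorem sum_notMem_range_constrainedEmb (htd : t ≤ d) (G : Fin (d + 1) → ℝ) :
    ∑ j with j ∉ Set.range (constrainedEmb htd) ∧ j ≠ Fin.last d, G j =
      ∑ i : Fin d with t ≤ i.val, G i.castSucc := by
  rw [Finset.sum_filter, Fin.sum_univ_castSucc, Finset.sum_filter]
  simp [castSucc_mem_range_constrainedEmb, (Fin.castSucc_lt_last _).ne, -Set.mem_range]

/-- Splitting a weighted quadratic form by the Cauchy–Schwarz inequality. -/
theorem weighted_sum_le {ι : Type*} [Fintype ι] (s : ι → Prop) [DecidablePred s] {p D : ι → ℝ}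
    (hp : ∀ i, 0 < p i) (hD : ∀ i, 0 ≤ D i) {m : ℝ} (hm : 0 ≤ m) :
    m * ∑ i with s i, D i + (∑ i with ¬s i, √(D i)) ^ 2 ≤
      (∑ i with s i, m / p i + ∑ i with ¬s i, 1 / p i) * ∑ i, p i * D i := by
  have hpD : ∀ i, 0 ≤ p i * D i := fun i => mul_nonneg (hp i).le (hD i)
  set S := ∑ i, p i * D i with hS
  have h1 : m * ∑ i with s i, D i ≤ (∑ i with s i, m / p i) * S := by
    rw [Finset.mul_sum, Finset.sum_mul]
    refine Finset.sum_le_sum fun i _ => ?_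
    calc m * D i = m / p i * (p i * D i) := by
          field_simp [(hp i).ne']
      _ ≤ m / p i * S := mul_le_mul_of_nonneg_left
          (Finset.single_le_sum (fun i _ => hpD i) (Finset.mem_univ i))
          (div_nonneg hm (hp i).le)
  have h2 : (∑ i with ¬s i, √(D i)) ^ 2 ≤ (∑ i with ¬s i, 1 / p i) * S := by
    -- Cauchy–Schwarz for `√(D i) = √(1 / p i) * √(p i * D i)`.
    refine (Finset.sum_sq_le_sum_mul_sum_of_sq_le_mul _ (f := fun i => 1 / p i)
      (g := fun i => p i * D i) (fun i _ => (one_div_pos.2 (hp i)).le) (fun i _ => hpD i)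
      fun i _ => ?_).trans ?_
    · rw [Real.sq_sqrt (hD i), ← mul_assoc, one_div_mul_cancel (hp i).ne', one_mul]
    · exact mul_le_mul_of_nonneg_left
        (Finset.sum_le_sum_of_subset_of_nonneg (Finset.filter_subset _ _) fun i _ _ => hpD i)
        (Finset.sum_nonneg fun i _ => (one_div_pos.2 (hp i)).le)
  linarith

end Clique

/-! ### Proof of the relaxation time bound -/

theorem mainTheorem2 (t : ℕ) (ht : 1 ≤ t) :
    ∃ C : ℝ, 0 < C ∧
      ∀ (d : ℕ), 1 ≤ d →
      ∀ (L : Fin d → Finset (Fin (d + 1))), IsFeasible t L →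
      ∀ (p : Fin d → ℝ), (∀ i, 0 < p i) →
        IsErgodicGenerator (glauberGenerator (⊤ : SimpleGraph (Fin d)) L p) ∧
        0 < spectralGap (glauberGenerator (⊤ : SimpleGraph (Fin d)) L p) ∧
        relaxationTime (glauberGenerator (⊤ : SimpleGraph (Fin d)) L p) ≤
          C * ((∑ i : Fin d with i.val < t, (d : ℝ) / p i) +
            (∑ i : Fin d with t ≤ i.val, 1 / p i)) := by
  classical
  obtain ⟨C, hC, hpoin⟩ := listPerms_poincare t
  -- The factor 2 absorbs `d + 1 ≤ 2 * d`: the Poincaré inequality counts `d + 1` positions.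
  refine ⟨2 * C, by positivity, fun d hd L hL p hp => ?_⟩
  have htd := hL.le hd
  have hd' : (1 : ℝ) ≤ d := by exact_mod_cast hd
  set Q := glauberGenerator (⊤ : SimpleGraph (Fin d)) L p with hQdef
  set W := (∑ i : Fin d with i.val < t, (d : ℝ) / p i) + ∑ i : Fin d with t ≤ i.val, 1 / p i
    with hW
  have hW0 : 0 < W := by
    refine add_pos_of_pos_of_nonneg (Finset.sum_pos (fun i _ => div_pos (by linarith) (hp i))
      ⟨⟨0, hd⟩, ?_⟩) (Finset.sum_nonneg fun i _ => (one_div_pos.2 (hp i)).le)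
    simpa using Nat.lt_of_succ_le ht
  have hK : 0 < 2 * C * W := by positivity
  have hcard := two_le_card_listColouring hL hd
  have hQ : Q.IsSymm := glauberGenerator_isSymm _ _ _
  have key : ∀ f : ListColouring (⊤ : SimpleGraph (Fin d)) L → ℝ,
      ∑ x, ∑ y, (f x - f y) ^ 2 ≤
        2 * C * W * Fintype.card (ListColouring (⊤ : SimpleGraph (Fin d)) L) *
          ∑ x, ∑ y, Q x y * (f x - f y) ^ 2 := by
    intro f
    set D : Fin d → ℝ := fun i => permDirichlet (constrainedEmb htd) (constrainedLists htd L)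
      (liftToPerm hL htd f) (Equiv.swap i.castSucc (Fin.last d)) with hDdef
    have hD0 : ∀ i, 0 ≤ D i := fun i => permDirichlet_nonneg _ _ _ _
    have h1 := hpoin (Fin (d + 1)) (constrainedEmb htd) (constrainedLists htd L)
      (fun k => hL.constrained _ k.isLt) (Fin.last d) (last_notMem_range_constrainedEmb htd)
      (liftToPerm hL htd f)
    rw [sum_sq_sub_liftToPerm, ← card_listColouring hL htd,
      sum_constrainedEmb htd fun j => permDirichlet (constrainedEmb htd) (constrainedLists htd L)
        (liftToPerm hL htd f) (Equiv.swap j (Fin.last d)),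
      sum_notMem_range_constrainedEmb htd, Fintype.card_fin] at h1
    have h2 := weighted_sum_le (fun i : Fin d => i.val < t) hp hD0 (Nat.cast_nonneg d)
    simp only [not_lt] at h2
    rw [← hW] at h2
    have h3 : ∑ i, p i * D i ≤ ∑ x, ∑ y, Q x y * (f x - f y) ^ 2 := by
      rw [hQdef, sum_glauberGenerator_mul_sq]
      exact Finset.sum_le_sum fun i _ =>
        mul_le_mul_of_nonneg_left (permDirichlet_liftToPerm_le hL htd f i) (hp i).le
    set N : ℝ := (Fintype.card (ListColouring (⊤ : SimpleGraph (Fin d)) L) : ℝ) with hN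
    have hN0 : 0 ≤ N := Nat.cast_nonneg _
    have h4 : ((d + 1 : ℕ) : ℝ) * ∑ i : Fin d with i.val < t, D i +
        (∑ i : Fin d with t ≤ i.val, √(D i)) ^ 2 ≤
        2 * (W * ∑ x, ∑ y, Q x y * (f x - f y) ^ 2) := by
      have h5 : 0 ≤ ∑ i : Fin d with i.val < t, D i := Finset.sum_nonneg fun i _ => hD0 i
      have h6 := mul_le_mul_of_nonneg_left h3 hW0.le
      push_cast
      nlinarith [sq_nonneg (∑ i : Fin d with t ≤ i.val, √(D i))]
    refine h1.trans ((mul_le_mul_of_nonneg_left h4 (by positivity)).trans_eq ?_)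
    ring
  have hgap := inv_le_spectralGap_of_poincare hQ (sum_glauberGenerator _ _ _) hcard hK key
  have hpos : 0 < spectralGap Q := (inv_pos.2 hK).trans_le hgap
  refine ⟨isErgodicGenerator_of_poincare hQ (by positivity) key, hpos, ?_⟩
  rw [relaxationTime, one_div]
  exact inv_le_of_inv_le₀ hK hgap
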